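/- Let $(Q,N)$ be a pair of (possibly dependent) random variables, where $Q\ge 0$ is real-valued and $N$ takes values in $\{0,1,2,\dots\}$, and suppose that $\bar n=\mathbb E N<1$ and $\bar q=\mathbb E Q<\infty$. Consider the fixed-point equation $$R \overset{d}{=} Q+\sum_{m=1}^{N}R_m, \tag{1}$$ where $R_1,R_2,\dots$ are i.i.d. copies of $R$, independent of the pair $(Q,N)$. A solution is understood as a probability distribution (the law of $R$). A distribution $F$ on $\mathbb R$ with tail $\overline F(x)=F((x,\infty))$ is called *regularly varying* if $\overline F(x)=x^{-\beta}L(x)$ for $x>0$, for some $\beta>0$ and some function $L$ that is slowly varying at infinity, and *intermediate regularly varying* (IRV) if its support is unbounded above and $$\lim_{\alpha\uparrow1}\limsup_{x\to\infty}\overline F(\alpha x)/\overline F(x)=1 .$$ We write $f(x)\sim g(x)$ if $f(x)=g(x)(1+o(1))$ as $x\to\infty$. (i) Equation (1) has exactly one non-negative solution $R$ with finite mean, and its mean is $\bar r=\bar q/(1-\bar n)$. (ii) Suppose that, for some $\epsilon>0$, **(C)** the distribution of $Q+cN$ is IRV for all $c>0$ in the interval $(\bar r-\epsilon,\bar r+\epsilon)$.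 Then the solution $R$ in (i) satisfies $$\mathbb P(R>x)\sim\frac{1}{1-\bar n}\,\mathbb P(Q+\bar r N>x)\qquad\text{as }x\to\infty .$$ (iii) Condition (C) holds (for some $\epsilon>0$) in each of the following three cases: (a) $(Q,N)$ is 2-dimensionally regularly varying, that is, with $\|(u,v)\|=|u|+|v|$, the distribution of $\|(Q,N)\|$ is regularly varying and, as $x\to\infty$, the conditional distribution of $(Q,N)/\|(Q,N)\|$ given $\|(Q,N)\|>x$ converges weakly to a probability measure on the unit sphere $\{\|v\|=1\}$; (b) the distribution of $Q$ is IRV and $\mathbb P(N>x)=o(\mathbb P(Q>x))$ as $x\to\infty$; (c) the distribution of $N$ is IRV and $\mathbb P(Q>x)=o(\mathbb P(N>x))$ as $x\to\infty$. -/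

import Mathlib

open MeasureTheory ProbabilityTheory Filter Topology Asymptotics
open scoped ENNReal BoundedContinuousFunction

namespace RandomSum

noncomputable section

/-- A law `ν` on `ℝ`, with tail `F̄ x = ν (x, ∞)`, is intermediate regularly varying:
`lim_{α ↑ 1} limsup_{x → ∞} F̄ (α x) / F̄ x = 1`.
The quotient is taken in `[0, ∞]`, so the upper limit always exists. A law whose support is
bounded above is excluded: there the quotient is `0 / 0 = 0` for all large `x`. -/
def IsIRV (ν : Measure ℝ) : Prop :=
  Tendsto (fun α : ℝ =>
      limsup (fun x : ℝ => ν (Set.Ioi (α * x)) / ν (Set.Ioi x)) atTop)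
    (𝓝[<] (1 : ℝ)) (𝓝 (1 : ℝ≥0∞))

/-- Slow variation at infinity. -/
def IsSlowlyVarying (L : ℝ → ℝ) : Prop :=
  (∀ᶠ x in atTop, 0 < L x) ∧
    ∀ t : ℝ, 0 < t → Tendsto (fun x : ℝ => L (t * x) / L x) atTop (𝓝 1)

/-- A law `ν` on `ℝ` is regularly varying: `F̄ x = x ^ (-β) * L x` for some `β > 0` and some
slowly varying function `L`. -/
def IsRV (ν : Measure ℝ) : Prop :=
  ∃ β : ℝ, 0 < β ∧ ∃ L : ℝ → ℝ, IsSlowlyVarying L ∧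
    ∀ x : ℝ, 0 < x → ν.real (Set.Ioi x) = x ^ (-β) * L x

/-- The `L₁` norm on the plane. -/
def norm₁ (v : ℝ × ℝ) : ℝ := |v.1| + |v.2|

/-- A law `ν` on the plane is (2-dimensional) regularly varying, in polar `L₁`-coordinates:
the law of the norm is regularly varying, and the conditional law of the angular part
`v / ‖v‖₁` given `‖v‖₁ > x` converges weakly, as `x → ∞`, to a probability measure `S`
carried by the unit sphere of `‖·‖₁`. -/
def IsMRV (ν : Measure (ℝ × ℝ)) : Prop :=
  IsRV (ν.map norm₁) ∧
    ∃ S : Measure (ℝ × ℝ), IsProbabilityMeasure S ∧ (∀ᵐ v ∂S, norm₁ v = 1) ∧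
      ∀ f : (ℝ × ℝ) →ᵇ ℝ,
        Tendsto (fun x : ℝ => ∫ v, f ((norm₁ v)⁻¹ • v) ∂(cond ν {v | x < norm₁ v}))
          atTop (𝓝 (∫ v, f v ∂S))

variable {Ω : Type*} [MeasurableSpace Ω]

/-- The law of `Q + ∑_{m = 1}^N R_m`, where `R_1, R_2, …` are i.i.d. with law `ν` and the
sequence `(R_m)` is independent of the (possibly dependent) pair `(Q, N)`.
It is computed on the product space that carries the joint law of `(Q, N)` and the infinite
product of copies of `ν`; the summand `R_{m+1}` is the coordinate `m`. -/
def randomSumLaw (μ : Measure Ω) (Q : Ω → ℝ) (N : Ω → ℕ) (ν : Measure ℝ) : Measure ℝ :=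
  ((μ.map (fun ω => (Q ω, N ω))).prod (Measure.infinitePi (fun _ : ℕ => ν))).map
    (fun z : (ℝ × ℕ) × (ℕ → ℝ) => z.1.1 + ∑ m ∈ Finset.range z.1.2, z.2 m)

/-- `ν` is the law of a non-negative solution `R` of `R =_d Q + ∑_{m = 1}^N R_m`. -/
def IsNonnegSolution (μ : Measure Ω) (Q : Ω → ℝ) (N : Ω → ℕ) (ν : ProbabilityMeasure ℝ) :
    Prop :=
  (∀ᵐ x ∂(ν : Measure ℝ), 0 ≤ x) ∧ randomSumLaw μ Q N ν = (ν : Measure ℝ)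

/-- The law `ν` on `ℝ` has a finite mean. -/
def HasFiniteMean (ν : ProbabilityMeasure ℝ) : Prop :=
  Integrable (fun x : ℝ => x) (ν : Measure ℝ)

/-- `r̄ = q̄ / (1 - n̄)`. -/
def rBar (μ : Measure Ω) (Q : Ω → ℝ) (N : Ω → ℕ) : ℝ :=
  (∫ ω, Q ω ∂μ) / (1 - ∫ ω, (N ω : ℝ) ∂μ)

/-- Condition (C): for some `ε > 0`, the law of `Q + c N` is intermediate regularly varying for
all `c > 0` in the interval `(r̄ - ε, r̄ + ε)`. -/
def ConditionC (μ : Measure Ω) (Q : Ω → ℝ) (N : Ω → ℕ) : Prop :=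
  ∃ ε : ℝ, 0 < ε ∧ ∀ c ∈ Set.Ioo (rBar μ Q N - ε) (rBar μ Q N + ε), 0 < c →
    IsIRV (μ.map (fun ω => Q ω + c * (N ω : ℝ)))

end

end RandomSum

/-! Write n̄ = E N, G for the tail of the solution R and F for the tail of Q + r̄N.

(i) Conditioning on (Q, N), the map ν ↦ law of Q + ∑ R_m sends the characteristic function φ to
E[exp(itQ) φ(t)^N]. Since |a^n - b^n| ≤ n|a - b| on the unit disc, it contracts characteristic
functions, pointwise in t, by the factor n̄ < 1 (`norm_charFun_randomSumLaw_sub_le`). This gives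
uniqueness, and geometric convergence of the iterates started at the point mass at 0. Lévy
continuity, tightness and Fatou turn their limit into a solution of finite mean; taking expectations
gives r̄.

(ii) A random sum is large for one of two reasons: either Q + r̄N is already large and the law of
large numbers does the rest, or Q + r̄N is moderate and one summand is large, which contributes
about n̄ G(x). Hence heuristically G ≈ F + n̄G, so G ≈ F / (1 - n̄). For the upper bound,
`sumTail_sub_le` splits the event. The nontrivial remainder has all summands at most δx/k and N ≤
κx. An exponential bound makes its probability a constant times (N/x)^k, and
`exists_truncPow_integral_le` bounds the mean of that by a small multiple of F. The result is G(x) ≤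
(1 + ε)F(x) + n̄ G(αx) + ε' G(ηx) for large x. A first use gives G = O(F); a bound G ≤ KF then
improves to G ≤ (1 + ε + n̄K)F, and iteration yields the constant 1/(1 - n̄). For the lower bound
the two scenarios are disjoint, and their probabilities add up to at least (1 - ε)F(x/α) + (n̄ -
ε)G(x), which is solved for G directly. The replacement of r̄ by r̄ ± δ costs only a rescaling of x,
because Q + (r̄ + δ)N ≤ (1 + δ/r̄)(Q + r̄N) and similarly below; intermediate regular variation
(IRV) absorbs it.

(iii) A summand with negligible tail does not affect IRV (`isIRVTail_add_of_isLittleO`). In the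
regularly varying case a partition of unity on the angular part squeezes the tail of Q + cN between
sums with comparable limits (`IsMRV.isIRVTail`). -/

namespace RandomSum

/-! ### Intermediate regularly varying tails -/

/-- A real-valued tail function is intermediate regularly varying. -/
def IsIRVTail (F : ℝ → ℝ) : Prop :=
  (∀ x, 0 < F x) ∧ ∀ ε : ℝ, 0 < ε → ∃ α : ℝ, 0 < α ∧ α < 1 ∧
    ∀ᶠ x in atTop, F (α * x) ≤ (1 + ε) * F x

theorem antitone_real_Ioi (ν : Measure ℝ) [IsFiniteMeasure ν] :
    Antitone fun x : ℝ => ν.real (Set.Ioi x) :=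
  fun _ _ h => measureReal_mono (Set.Ioi_subset_Ioi h)

/-- Positivity everywhere comes from the convention 0 / 0 = 0: if the tail vanished somewhere, every
upper limit would be 0 and could not tend to 1. -/
theorem IsIRV.isIRVTail {ν : Measure ℝ} [IsFiniteMeasure ν] (h : IsIRV ν) :
    IsIRVTail fun x => ν.real (Set.Ioi x) := by
  have hα : ∀ᶠ α : ℝ in 𝓝[<] (1 : ℝ), α ∈ Set.Ioo (0 : ℝ) 1 :=
    Ioo_mem_nhdsLT zero_lt_one
  refine ⟨fun x₀ => ?_, fun ε hε => ?_⟩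
  · by_contra hx
    have hx0 : ν.real (Set.Ioi x₀) = 0 := le_antisymm (not_lt.1 hx) measureReal_nonneg
    have hν : ∀ y, x₀ ≤ y → ν (Set.Ioi y) = 0 := fun y hy =>
      measure_mono_null (Set.Ioi_subset_Ioi hy) ((measureReal_eq_zero_iff).1 hx0)
    have hev : ∀ᶠ α : ℝ in 𝓝[<] (1 : ℝ),
        limsup (fun x : ℝ => ν (Set.Ioi (α * x)) / ν (Set.Ioi x)) atTop = 0 := by
      filter_upwards [hα] with α hα
      have : (fun x : ℝ => ν (Set.Ioi (α * x)) / ν (Set.Ioi x)) =ᶠ[atTop] fun _ => 0 := by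
        filter_upwards [(tendsto_id.const_mul_atTop hα.1).eventually_ge_atTop x₀] with x hx
        simp only [id] at hx
        rw [hν _ hx, ENNReal.zero_div]
      rw [limsup_congr this]
      simp
    have h0 := tendsto_nhds_unique (tendsto_const_nhds.congr' (hev.mono fun _ h => h.symm)) h
    exact zero_ne_one h0
  · have h1 : (1 : ℝ≥0∞) < ENNReal.ofReal (1 + ε) := by
      rw [← ENNReal.ofReal_one]
      exact (ENNReal.ofReal_lt_ofReal_iff (by linarith)).2 (by linarith)
    obtain ⟨α, hl, h0, h1⟩ := ((h.eventually_lt_const h1).and hα).exists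
    refine ⟨α, h0, h1, ?_⟩
    filter_upwards [eventually_lt_of_limsup_lt hl] with x hx
    have hle : ν (Set.Ioi (α * x)) ≤ ENNReal.ofReal (1 + ε) * ν (Set.Ioi x) :=
      (ENNReal.div_le_iff_le_mul (Or.inr ENNReal.ofReal_ne_top)
        (Or.inl (measure_ne_top _ _))).1 hx.le
    have := ENNReal.toReal_mono (ENNReal.mul_ne_top ENNReal.ofReal_ne_top
      (measure_ne_top _ _)) hle
    rwa [ENNReal.toReal_mul, ENNReal.toReal_ofReal (by linarith)] at this

/-- The quotients are at least 1 by monotonicity, and an α that works for ε works for every α' in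
(α, 1). -/
theorem IsIRVTail.isIRV {ν : Measure ℝ} [IsFiniteMeasure ν]
    (h : IsIRVTail fun x => ν.real (Set.Ioi x)) : IsIRV ν := by
  have hpos : ∀ x, ν (Set.Ioi x) ≠ 0 := fun x hx => by
    have := h.1 x
    simp [measureReal_def, hx] at this
  refine tendsto_order.2 ⟨fun a ha => ?_, fun b hb => ?_⟩
  · filter_upwards [Ioo_mem_nhdsLT zero_lt_one] with α hα
    refine ha.trans_le (le_limsup_of_frequently_le ?_ (by isBoundedDefault))
    refine (Eventually.frequently ?_)
    filter_upwards [eventually_ge_atTop 0] with x hx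
    rw [ENNReal.le_div_iff_mul_le (Or.inl (hpos x)) (Or.inl (measure_ne_top _ _)), one_mul]
    exact measure_mono (Set.Ioi_subset_Ioi (by nlinarith [hα.2]))
  · obtain ⟨ε, hε, hb'⟩ : ∃ ε : ℝ, 0 < ε ∧ ENNReal.ofReal (1 + ε) < b := by
      obtain ⟨c, hc1, hcb⟩ := exists_between hb
      have hc : c ≠ ∞ := ne_top_of_lt hcb
      refine ⟨c.toReal - 1, ?_, ?_⟩
      · have := (ENNReal.toReal_lt_toReal (by simp) hc).2 hc1
        simp at this
        linarith
      · rwa [add_sub_cancel, ENNReal.ofReal_toReal hc]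
    obtain ⟨α, h0, h1, hα⟩ := h.2 ε hε
    filter_upwards [Ioo_mem_nhdsLT h1] with α' hα'
    refine lt_of_le_of_lt (limsup_le_of_le (by isBoundedDefault) ?_) hb'
    filter_upwards [hα, eventually_ge_atTop 0] with x hx hx0
    rw [ENNReal.div_le_iff_le_mul (Or.inl (hpos x)) (Or.inl (measure_ne_top _ _))]
    have h2 : ν.real (Set.Ioi (α' * x)) ≤ (1 + ε) * ν.real (Set.Ioi x) :=
      (antitone_real_Ioi ν (by nlinarith [hα'.1])).trans hx
    rw [← ofReal_measureReal (μ := ν) (s := Set.Ioi (α' * x)),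
      ← ofReal_measureReal (μ := ν) (s := Set.Ioi x), ← ENNReal.ofReal_mul (by linarith)]
    exact ENNReal.ofReal_le_ofReal h2

/-- Dominated variation: iterate the inequality F(αx) ≤ 2F(x) until α^n < t. -/
theorem IsIRVTail.exists_le_mul {F : ℝ → ℝ} (h : IsIRVTail F) (hF : Antitone F)
    {t : ℝ} (ht : 0 < t) : ∃ D : ℝ, 1 ≤ D ∧ ∀ᶠ x in atTop, F (t * x) ≤ D * F x := by
  obtain ⟨α, h0, h1, hα⟩ := h.2 1 one_pos
  obtain ⟨n, hn⟩ := exists_pow_lt_of_lt_one ht h1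
  have key : ∀ n : ℕ, ∀ᶠ x in atTop, F (α ^ n * x) ≤ 2 ^ n * F x := by
    intro n
    induction n with
    | zero => simp
    | succ n ih =>
      filter_upwards [ih, (tendsto_id.const_mul_atTop (pow_pos h0 n)).eventually hα] with x h1 h2
      simp only [id] at h2
      rw [pow_succ', mul_assoc, pow_succ]
      linarith
  refine ⟨2 ^ n, one_le_pow₀ (by norm_num), ?_⟩
  filter_upwards [key n, eventually_ge_atTop 0] with x hx hx0
  exact (hF (by nlinarith)).trans hx

/-- A tail that is squeezed against an intermediate regularly varying tail is itself one. -/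
theorem IsIRVTail.of_asymp {F H : ℝ → ℝ} (h : IsIRVTail F) (hH : Antitone H)
    (hl : ∀ ε : ℝ, 0 < ε → ∀ᶠ x in atTop, F x ≤ (1 + ε) * H x)
    (hu : ∀ ε : ℝ, 0 < ε → ∀ᶠ x in atTop, H x ≤ (1 + ε) * F x) : IsIRVTail H := by
  refine ⟨fun x => ?_, fun ε hε => ?_⟩
  · obtain ⟨y, hy, hxy⟩ := ((hl 1 one_pos).and (eventually_ge_atTop x)).exists
    have := h.1 y
    linarith [hH hxy]
  · obtain ⟨δ, hδ, hδ'⟩ : ∃ δ : ℝ, 0 < δ ∧ (1 + δ) ^ 3 ≤ 1 + ε := by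
      -- For δ ≤ 1 one has (1 + δ)^3 ≤ 1 + 7δ.
      refine ⟨min 1 (ε / 7), by positivity, ?_⟩
      have h1 : min 1 (ε / 7) ≤ 1 := min_le_left _ _
      have h2 : min 1 (ε / 7) ≤ ε / 7 := min_le_right _ _
      have h3 : 0 < min 1 (ε / 7) := by positivity
      set δ := min 1 (ε / 7)
      nlinarith [mul_pos h3 h3, mul_nonneg (mul_pos h3 h3).le (sub_nonneg.2 h1)]
    obtain ⟨α, h0, h1, hα⟩ := h.2 δ hδ
    refine ⟨α, h0, h1, ?_⟩
    filter_upwards [hα, hl δ hδ, (tendsto_id.const_mul_atTop h0).eventually (hu δ hδ)]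
      with x h1 h2 h3
    simp only [id] at h3
    have hFx := h.1 x
    have hHx : 0 ≤ H x := by
      by_contra hneg
      nlinarith
    calc H (α * x) ≤ (1 + δ) * ((1 + δ) * ((1 + δ) * H x)) :=
          h3.trans (by gcongr; exact h1.trans (by gcongr))
      _ = (1 + δ) ^ 3 * H x := by ring
      _ ≤ _ := by gcongr

/-- A locally bounded function that satisfies a contractive recursive inequality at large
arguments is bounded. -/
theorem exists_forall_le_of_recursive {h : ℝ → ℝ} {C θ ρ x₀ : ℝ} (hθ : θ < 1)
    (hρ0 : 0 < ρ) (hρ1 : ρ < 1) (hbdd : ∀ x, ∃ B, ∀ y ≤ x, h y ≤ B)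
    (hrec : ∀ x, x₀ ≤ x → ∀ K, 0 ≤ K → (∀ y ≤ ρ * x, h y ≤ K) → h x ≤ C + θ * K) :
    ∃ K, ∀ x, h x ≤ K := by
  obtain ⟨B, hB⟩ := hbdd (max x₀ 1)
  -- K dominates h on the initial range and satisfies C + θK ≤ K, so the recursion preserves the
  -- bound K; the induction reaches x once ρ^n x falls into the initial range.
  set K := max (max B 0) (C / (1 - θ)) with hK
  have hK0 : 0 ≤ K := (le_max_right _ _).trans (le_max_left _ _)
  have hKC : C + θ * K ≤ K := by
    have : C / (1 - θ) ≤ K := le_max_right _ _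
    rw [div_le_iff₀ (by linarith)] at this
    linarith
  have key : ∀ n : ℕ, ∀ x, ρ ^ n * x ≤ max x₀ 1 → h x ≤ K := by
    intro n
    induction n with
    | zero =>
      intro x hx
      rw [pow_zero, one_mul] at hx
      exact (hB x hx).trans ((le_max_left _ _).trans (le_max_left _ _))
    | succ n ih =>
      intro x hx
      rcases le_total x (max x₀ 1) with h1 | h1
      · exact (hB x h1).trans ((le_max_left _ _).trans (le_max_left _ _))
      · refine (hrec x ((le_max_left _ _).trans h1) K hK0 fun y hy => ih y ?_).trans hKC
        refine le_trans ?_ hx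
        rw [pow_succ, mul_assoc]
        gcongr
  refine ⟨K, fun x => ?_⟩
  have hm : 0 < max x₀ 1 := lt_max_of_lt_right one_pos
  have : Tendsto (fun n : ℕ => ρ ^ n * x) atTop (𝓝 (0 * x)) :=
    (tendsto_pow_atTop_nhds_zero_of_lt_one hρ0.le hρ1).mul_const x
  rw [zero_mul] at this
  obtain ⟨n, hn⟩ := (this.eventually_lt_const hm).exists
  exact key n x hn.le

/-! ### Sufficient conditions for (C) -/

section Sufficient

variable {Ω : Type*} [MeasurableSpace Ω]

theorem map_real_Ioi (μ : Measure Ω) {X : Ω → ℝ} (hX : Measurable X) (x : ℝ) :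
    (μ.map X).real (Set.Ioi x) = μ.real {ω | x < X ω} :=
  map_measureReal_apply hX measurableSet_Ioi

theorem isIRV_map_iff {μ : Measure Ω} [IsFiniteMeasure μ] {X : Ω → ℝ} (hX : Measurable X) :
    IsIRV (μ.map X) ↔ IsIRVTail fun x => μ.real {ω | x < X ω} := by
  simp_rw [← map_real_Ioi μ hX]
  exact ⟨IsIRV.isIRVTail, IsIRVTail.isIRV⟩

theorem antitone_tail (μ : Measure Ω) [IsFiniteMeasure μ] (X : Ω → ℝ) :
    Antitone fun x : ℝ => μ.real {ω | x < X ω} :=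
  fun _ _ h => measureReal_mono fun _ hω => lt_of_le_of_lt h hω

theorem IsIRVTail.comp_div {F : ℝ → ℝ} (h : IsIRVTail F) {a : ℝ} (ha : 0 < a) :
    IsIRVTail fun x => F (x / a) := by
  refine ⟨fun x => h.1 _, fun ε hε => ?_⟩
  obtain ⟨α, h0, h1, hα⟩ := h.2 ε hε
  refine ⟨α, h0, h1, ?_⟩
  filter_upwards [(tendsto_id.atTop_div_const ha).eventually hα] with x hx
  simpa [mul_div_assoc] using hx

/-- Adding a summand with a negligible tail preserves intermediate regular variation. -/
theorem isIRVTail_add_of_isLittleO {μ : Measure Ω} [IsFiniteMeasure μ] {X Y : Ω → ℝ}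
    (hY : ∀ᵐ ω ∂μ, 0 ≤ Y ω) (hX : IsIRVTail fun x => μ.real {ω | x < X ω})
    (hXY : (fun x : ℝ => μ.real {ω | x < Y ω}) =o[atTop] fun x : ℝ => μ.real {ω | x < X ω})
    {a b : ℝ} (ha : 0 < a) (hb : 0 < b) :
    IsIRVTail fun x => μ.real {ω | x < a * X ω + b * Y ω} := by
  refine (hX.comp_div ha).of_asymp (antitone_tail μ _) (fun ε hε => .of_forall fun x => ?_)
    fun ε hε => ?_
  · have : μ.real {ω | x / a < X ω} ≤ μ.real {ω | x < a * X ω + b * Y ω} := by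
      refine ENNReal.toReal_mono (measure_ne_top _ _) (measure_mono_ae ?_)
      filter_upwards [hY] with ω hω h
      have h' : x / a < X ω := h
      rw [div_lt_iff₀ ha] at h'
      change x < a * X ω + b * Y ω
      nlinarith [mul_nonneg hb.le hω]
    nlinarith [measureReal_nonneg (μ := μ) (s := {ω | x < a * X ω + b * Y ω})]
  -- If aX + bY > x, then aX > αx or bY > (1 - α)x. IRV handles the first event; dominated variation
  -- makes the second negligible.
  · obtain ⟨α, h0, h1, hα⟩ := (hX.comp_div ha).2 (ε / 2) (by positivity)
    have ht : 0 < (1 - α) / b := div_pos (by linarith) hb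
    obtain ⟨D, hD1, hD⟩ := hX.exists_le_mul (antitone_tail μ X) (mul_pos ht ha)
    have hD0 : 0 < D := by linarith
    filter_upwards [hα, (tendsto_id.atTop_div_const ha).eventually hD,
      (tendsto_id.const_mul_atTop ht).eventually
        (hXY.def (show 0 < ε / 2 / D by positivity))] with x h1 h2 h3
    simp only [id, Real.norm_eq_abs, abs_of_nonneg measureReal_nonneg] at h2 h3
    have e1 : (1 - α) / b * a * (x / a) = (1 - α) / b * x := by field_simp
    rw [e1] at h2
    have hsub : {ω | x < a * X ω + b * Y ω} ⊆
        {ω | α * x / a < X ω} ∪ {ω | (1 - α) / b * x < Y ω} := by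
      intro ω hω
      by_contra hcon
      simp only [Set.mem_union, Set.mem_ofPred_eq, not_or, not_lt, le_div_iff₀ ha] at hcon hω
      obtain ⟨hc1, hc2⟩ := hcon
      have : Y ω * b ≤ (1 - α) / b * x * b := by gcongr
      have e2 : (1 - α) / b * x * b = (1 - α) * x := by field_simp
      linarith
    calc μ.real {ω | x < a * X ω + b * Y ω}
        ≤ μ.real {ω | α * x / a < X ω} + μ.real {ω | (1 - α) / b * x < Y ω} :=
          (measureReal_mono hsub).trans (measureReal_union_le _ _)
      _ ≤ (1 + ε / 2) * μ.real {ω | x / a < X ω} +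
          ε / 2 / D * (D * μ.real {ω | x / a < X ω}) := by
          gcongr
          exact h3.trans (by gcongr)
      _ = (1 + ε) * μ.real {ω | x / a < X ω} := by field_simp; ring

theorem conditionC_of_isIRV_left {μ : Measure Ω} [IsProbabilityMeasure μ] {Q : Ω → ℝ} {N : Ω → ℕ}
    (hQ : Measurable Q) (hN : Measurable N) (h : IsIRV (μ.map Q))
    (ho : (fun x : ℝ => μ.real {ω | x < (N ω : ℝ)}) =o[atTop]
      fun x : ℝ => μ.real {ω | x < Q ω}) : ConditionC μ Q N := by
  refine ⟨1, one_pos, fun c _ hc => ?_⟩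
  rw [isIRV_map_iff (by fun_prop)]
  rw [isIRV_map_iff hQ] at h
  simpa using isIRVTail_add_of_isLittleO (.of_forall fun ω => Nat.cast_nonneg (N ω)) h ho
    one_pos hc

theorem conditionC_of_isIRV_right {μ : Measure Ω} [IsProbabilityMeasure μ] {Q : Ω → ℝ} {N : Ω → ℕ}
    (hQ : Measurable Q) (hN : Measurable N) (hQ0 : ∀ᵐ ω ∂μ, 0 ≤ Q ω)
    (h : IsIRV (μ.map fun ω => (N ω : ℝ)))
    (ho : (fun x : ℝ => μ.real {ω | x < Q ω}) =o[atTop]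
      fun x : ℝ => μ.real {ω | x < (N ω : ℝ)}) : ConditionC μ Q N := by
  refine ⟨1, one_pos, fun c _ hc => ?_⟩
  rw [isIRV_map_iff (by fun_prop)]
  rw [isIRV_map_iff (by fun_prop)] at h
  simpa [add_comm] using isIRVTail_add_of_isLittleO hQ0 h ho hc one_pos

/-! ### Two-dimensional regular variation -/

section Angular

/-- The integral of a function of the angular part over the complement of a ball. -/
noncomputable def angularTail (P : Measure (ℝ × ℝ)) (f : ℝ × ℝ → ℝ) (x : ℝ) : ℝ :=
  ∫ v in {v | x < norm₁ v}, f ((norm₁ v)⁻¹ • v) ∂P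

theorem continuous_norm₁ : Continuous norm₁ := by
  unfold norm₁
  fun_prop

theorem tendsto_tail_div_of_isSlowlyVarying {T L : ℝ → ℝ} {β : ℝ} (hL : IsSlowlyVarying L)
    (hT : ∀ x, 0 < x → T x = x ^ (-β) * L x) {t : ℝ} (ht : 0 < t) :
    Tendsto (fun x => T (x / t) / T x) atTop (𝓝 (t ^ β)) := by
  have h := (hL.2 t⁻¹ (inv_pos.2 ht)).const_mul (t ^ β)
  rw [mul_one] at h
  refine h.congr' ?_
  filter_upwards [eventually_gt_atTop 0, hL.1] with x hx hLx
  rw [hT x hx, hT (x / t) (by positivity), Real.div_rpow hx.le ht.le, Real.rpow_neg ht.le,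
    div_eq_inv_mul x t]
  have := Real.rpow_pos_of_pos hx (-β)
  field_simp

/-- The quotient is the conditional mean of f at level x / t, which converges to its S-mean, times
T(x / t) / T(x) → t^β, where T is the tail of the norm. -/
theorem tendsto_angularTail_div {P : Measure (ℝ × ℝ)} [IsFiniteMeasure P] {L : ℝ → ℝ} {β : ℝ}
    (hL : IsSlowlyVarying L)
    (hT : ∀ x, 0 < x → P.real {v | x < norm₁ v} = x ^ (-β) * L x) {S : Measure (ℝ × ℝ)}
    {f : (ℝ × ℝ) →ᵇ ℝ}
    (hf : Tendsto (fun x : ℝ => ∫ v, f ((norm₁ v)⁻¹ • v) ∂(cond P {v | x < norm₁ v}))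
      atTop (𝓝 (∫ v, f v ∂S))) {t : ℝ} (ht : 0 < t) :
    Tendsto (fun x => angularTail P f (x / t) / P.real {v | x < norm₁ v}) atTop
      (𝓝 ((∫ v, f v ∂S) * t ^ β)) := by
  have h1 := (hf.comp (tendsto_id.atTop_div_const ht)).mul
    (tendsto_tail_div_of_isSlowlyVarying hL hT ht)
  refine h1.congr' ?_
  have hpos : ∀ᶠ x in atTop, 0 < P.real {v | x < norm₁ v} := by
    filter_upwards [eventually_gt_atTop 0, hL.1] with x hx hLx
    rw [hT x hx]
    positivity
  filter_upwards [(tendsto_id.atTop_div_const ht).eventually hpos] with x hx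
  simp only [id, Function.comp] at hx ⊢
  rw [ProbabilityTheory.cond, integral_smul_measure, angularTail, ENNReal.toReal_inv, smul_eq_mul,
    ← measureReal_def]
  have key : ∀ I p q : ℝ, p ≠ 0 → p⁻¹ * I * (p / q) = I / q := fun I p q hp => by field_simp
  exact key _ _ _ hx.ne'

/-- The continuous function that is `0` below `u`, is `1` above `w`, and is affine between. -/
noncomputable def ramp (u w y : ℝ) : ℝ := max 0 (min 1 ((y - u) / (w - u)))

theorem continuous_ramp (u w : ℝ) : Continuous (ramp u w) := by
  unfold ramp
  fun_prop

theorem ramp_nonneg (u w y : ℝ) : 0 ≤ ramp u w y := le_max_left _ _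

theorem ramp_le_one (u w y : ℝ) : ramp u w y ≤ 1 := max_le zero_le_one (min_le_left _ _)

theorem ramp_eq_zero {u w y : ℝ} (huw : u < w) (hy : y ≤ u) : ramp u w y = 0 :=
  max_eq_left ((min_le_right _ _).trans
    (div_nonpos_of_nonpos_of_nonneg (by linarith) (by linarith)))

theorem ramp_eq_one {u w y : ℝ} (huw : u < w) (hy : w ≤ y) : ramp u w y = 1 := by
  have : 1 ≤ (y - u) / (w - u) := by
    rw [le_div_iff₀ (by linarith)]
    linarith
  rw [ramp, min_eq_left this, max_eq_right zero_le_one]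

theorem integrable_indicator_angular (P : Measure (ℝ × ℝ)) [IsFiniteMeasure P]
    (f : (ℝ × ℝ) →ᵇ ℝ) (x : ℝ) :
    Integrable (Set.indicator {v | x < norm₁ v} fun v => f ((norm₁ v)⁻¹ • v)) P := by
  have hm : Measurable norm₁ := continuous_norm₁.measurable
  refine Integrable.indicator ?_ (measurableSet_lt measurable_const hm)
  refine Integrable.of_bound
    (f.continuous.measurable.comp (hm.inv.smul measurable_id)).aestronglyMeasurable ‖f‖
    (.of_forall fun v => f.norm_coe_le_norm _)

theorem angularTail_eq_integral_indicator (P : Measure (ℝ × ℝ)) (f : (ℝ × ℝ) → ℝ) (x : ℝ) :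
    angularTail P f x = ∫ v, Set.indicator {v | x < norm₁ v} (fun v => f ((norm₁ v)⁻¹ • v)) v ∂P :=
  (integral_indicator (measurableSet_lt measurable_const continuous_norm₁.measurable)).symm

/-- A multivariate regularly varying law on the quadrant has intermediate regularly varying
linear functionals. -/
theorem IsMRV.isIRVTail {P : Measure (ℝ × ℝ)} [IsProbabilityMeasure P] (h : IsMRV P)
    (hP : ∀ᵐ v ∂P, 0 ≤ v.1 ∧ 0 ≤ v.2) {c : ℝ} (hc : 0 < c) :
    IsIRVTail fun x => P.real {v | x < v.1 + c * v.2} := by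
  obtain ⟨⟨β, hβ, L, hL, hT⟩, S, hS, -, hf⟩ := h
  have hn : Measurable norm₁ := continuous_norm₁.measurable
  simp_rw [map_real_Ioi P hn] at hT
  set T : ℝ → ℝ := fun x => P.real {v | x < norm₁ v} with hTdef
  have hTpos : ∀ᶠ x in atTop, 0 < T x := by
    filter_upwards [eventually_gt_atTop 0, hL.1] with x hx hLx
    change 0 < P.real {v | x < norm₁ v}
    rw [hT x hx]
    positivity
  set a := min 1 c with ha
  set b := max 1 c with hb
  have ha0 : 0 < a := lt_min one_pos hc
  have hb0 : 0 < b := lt_max_of_lt_left one_pos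
  set g : ℝ × ℝ → ℝ := fun v => v.1 + c * v.2 with hg
  have hgc : Continuous g := by fun_prop
  have hgab : ∀ v : ℝ × ℝ, 0 ≤ v.1 → 0 ≤ v.2 → a * norm₁ v ≤ g v ∧ g v ≤ b * norm₁ v := by
    intro v h1 h2
    simp only [norm₁, abs_of_nonneg h1, abs_of_nonneg h2, hg]
    have e1 : a ≤ 1 := min_le_left _ _
    have e2 : a ≤ c := min_le_right _ _
    have e3 : 1 ≤ b := le_max_left _ _
    have e4 : c ≤ b := le_max_right _ _
    constructor <;> nlinarith
  -- Of the three factors s, one is the shift from x to x / s and two are the width of the cells of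
  -- a geometric partition of the values of g on the sphere.
  have key : ∀ s : ℝ, 1 < s → ∀ ε : ℝ, s ^ (3 * β) < 1 + ε → ∀ᶠ x in atTop,
      P.real {v | s⁻¹ * x < g v} ≤ (1 + ε) * P.real {v | x < g v} := by
    intro s hs ε hsε
    have hs0 : 0 < s := by linarith
    set l : ℕ → ℝ := fun i => a / s * s ^ i with hl
    have hl0 : ∀ i, 0 < l i := fun i => by positivity
    have hlsucc : ∀ i, l (i + 1) = s * l i := fun i => by simp only [hl]; ring
    have hlt : ∀ i, l i < l (i + 1) := fun i => by rw [hlsucc]; nlinarith [hl0 i]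
    have hlmono : StrictMono l := strictMono_nat_of_lt_succ hlt
    obtain ⟨J, hJ⟩ : ∃ J, b < l J := by
      obtain ⟨J, hJ⟩ := pow_unbounded_of_one_lt (b / (a / s)) hs
      exact ⟨J, by rwa [div_lt_iff₀' (by positivity)] at hJ⟩
    set r : ℕ → ℝ × ℝ → ℝ := fun i v => ramp (l i) (l (i + 1)) (g v) with hr
    have hbound : ∀ i v, ‖r i v - r (i + 1) v‖ ≤ 1 := fun i v => by
      rw [Real.norm_eq_abs, abs_le]
      have h1 := ramp_nonneg (l i) (l (i + 1)) (g v)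
      have h2 := ramp_le_one (l i) (l (i + 1)) (g v)
      have h3 := ramp_nonneg (l (i + 1)) (l (i + 1 + 1)) (g v)
      have h4 := ramp_le_one (l (i + 1)) (l (i + 1 + 1)) (g v)
      constructor <;> simp only [hr] <;> linarith
    -- The bump f i lives on l i < g < s² l i. The sum over i < J telescopes to 1 on a ≤ g ≤ b,
    -- because l 1 = a and l J > b. Continuous bumps avoid any question of S charging the cell
    -- boundaries.
    set f : ℕ → (ℝ × ℝ) →ᵇ ℝ := fun i => BoundedContinuousFunction.ofNormedAddCommGroup
      (fun v => r i v - r (i + 1) v)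
      (((continuous_ramp _ _).comp hgc).sub ((continuous_ramp _ _).comp hgc)) 1 (hbound i) with hfdef
    have hfapp : ∀ i v, f i v = r i v - r (i + 1) v := fun i v => rfl
    have hf0 : ∀ i v, 0 ≤ f i v := fun i v => by
      rw [hfapp, sub_nonneg]
      rcases le_total (g v) (l (i + 1)) with h1 | h1
      · simp only [hr]
        rw [ramp_eq_zero (hlt _) h1]
        exact ramp_nonneg _ _ _
      · simp only [hr]
        rw [ramp_eq_one (hlt i) h1]
        exact ramp_le_one _ _ _
    have hflow : ∀ i v, g v ≤ l i → f i v = 0 := fun i v hv => by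
      rw [hfapp]
      simp only [hr]
      rw [ramp_eq_zero (hlt i) hv, ramp_eq_zero (hlt (i + 1)) (hv.trans (hlt i).le), sub_zero]
    have hfhigh : ∀ i v, s ^ 2 * l i ≤ g v → f i v = 0 := fun i v hv => by
      have e : l (i + 1 + 1) = s ^ 2 * l i := by rw [hlsucc, hlsucc]; ring
      rw [hfapp]
      simp only [hr]
      rw [ramp_eq_one (hlt (i + 1)) (by rwa [e]),
        ramp_eq_one (hlt i) ((hlt (i + 1)).le.trans (by rwa [e])), sub_self]
    have hsum : ∀ v, a ≤ g v → g v ≤ b → ∑ i ∈ Finset.range J, f i v = 1 := fun v h1 h2 => by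
      simp_rw [hfapp]
      rw [Finset.sum_range_sub' (fun i => r i v)]
      simp only [hr]
      have e : l (0 + 1) = a := by simp only [hl, zero_add, pow_one]; field_simp
      rw [ramp_eq_one (hlt 0) (by rwa [e]), ramp_eq_zero (hlt J) (h2.trans hJ.le), sub_zero]
    have hgs : ∀ v : ℝ × ℝ, g ((norm₁ v)⁻¹ • v) = (norm₁ v)⁻¹ * g v := fun v => by
      simp only [hg, Prod.smul_fst, Prod.smul_snd, smul_eq_mul]
      ring
    have hsum' : ∀ v : ℝ × ℝ, 0 ≤ v.1 → 0 ≤ v.2 → 0 < norm₁ v →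
        ∑ i ∈ Finset.range J, f i ((norm₁ v)⁻¹ • v) = 1 := fun v h1 h2 h3 => by
      obtain ⟨h4, h5⟩ := hgab v h1 h2
      refine hsum _ ?_ ?_
      · rw [hgs, inv_mul_eq_div, le_div_iff₀ h3]
        exact h4
      · rw [hgs, inv_mul_eq_div, div_le_iff₀ h3]
        exact h5
    have hgm : ∀ y, MeasurableSet {v | y < g v} := fun y =>
      measurableSet_lt measurable_const hgc.measurable
    have htail : ∀ y, P.real {v | y < g v} = ∫ v, Set.indicator {v | y < g v} (fun _ => (1 : ℝ)) v ∂P :=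
      fun y => by rw [integral_indicator (hgm y)]; simp
    have hgint : ∀ y, Integrable (Set.indicator {v | y < g v} (fun _ => (1 : ℝ))) P := fun y =>
      (integrable_const _).indicator (hgm y)
    -- Since g is homogeneous, where f i is nonzero at the angular part, g v lies between l i and s²
    -- l i times the norm. This gives the upper bound here and the lower bound `hlower`.
    have hupper : ∀ y, 0 < y → P.real {v | y < g v} ≤
        ∑ i ∈ Finset.range J, angularTail P (f i) (y / (s ^ 2 * l i)) := by
      intro y hy
      simp_rw [angularTail_eq_integral_indicator, htail]
      rw [← integral_finsetSum _ fun i _ => integrable_indicator_angular P _ _]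
      refine integral_mono_ae (hgint y)
        (integrable_finsetSum _ fun i _ => integrable_indicator_angular P _ _) ?_
      filter_upwards [hP] with v hv
      by_cases hgv : y < g v
      · have hn0 : 0 < norm₁ v := by
          by_contra hcon
          have := (hgab v hv.1 hv.2).2
          nlinarith
        rw [Set.indicator_of_mem (by exact hgv), ← hsum' v hv.1 hv.2 hn0]
        refine Finset.sum_le_sum fun i _ => ?_
        by_cases hi : y / (s ^ 2 * l i) < norm₁ v
        · rw [Set.indicator_of_mem (by exact hi)]
        · rw [Set.indicator_of_notMem (by exact hi)]
          refine (hfhigh i _ ?_).le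
          rw [not_lt, le_div_iff₀ (by have := hl0 i; positivity)] at hi
          rw [hgs, inv_mul_eq_div, le_div_iff₀ hn0]
          linarith
      · rw [Set.indicator_of_notMem (by exact hgv)]
        exact Finset.sum_nonneg fun i _ => Set.indicator_nonneg (fun v _ => hf0 i _) _
    have hlower : ∀ y, 0 < y → ∑ i ∈ Finset.range J, angularTail P (f i) (y / l i) ≤
        P.real {v | y < g v} := by
      intro y hy
      simp_rw [angularTail_eq_integral_indicator, htail]
      rw [← integral_finsetSum _ fun i _ => integrable_indicator_angular P _ _]
      refine integral_mono_ae
        (integrable_finsetSum _ fun i _ => integrable_indicator_angular P _ _) (hgint y) ?_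
      filter_upwards [hP] with v hv
      by_cases hn0 : 0 < norm₁ v
      swap
      · refine (Finset.sum_nonpos fun i _ => ?_).trans
          (Set.indicator_nonneg (fun _ _ => zero_le_one) _)
        rw [Set.indicator_of_notMem]
        have := hl0 i
        have : 0 < y / l i := by positivity
        simp only [Set.mem_ofPred_eq]
        linarith
      by_cases hgv : y < g v
      · rw [Set.indicator_of_mem (by exact hgv), ← hsum' v hv.1 hv.2 hn0]
        exact Finset.sum_le_sum fun i _ => Set.indicator_le_self' (fun v _ => hf0 i _) _
      · rw [Set.indicator_of_notMem (by exact hgv)]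
        refine (Finset.sum_eq_zero fun i _ => ?_).le
        by_cases hi : y / l i < norm₁ v
        · rw [Set.indicator_of_mem (by exact hi)]
          refine hflow i _ ?_
          rw [div_lt_iff₀ (hl0 i)] at hi
          rw [hgs, inv_mul_eq_div, div_le_iff₀ hn0]
          linarith
        · rw [Set.indicator_of_notMem (by exact hi)]
    have hlower' : ∀ y, 0 < y → T (y / l 0) ≤
        ∑ i ∈ Finset.range J, angularTail P (f i) (y / l i) := by
      intro y hy
      have e : T (y / l 0) = ∫ v, Set.indicator {v | y / l 0 < norm₁ v} (fun _ => (1 : ℝ)) v ∂P := by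
        rw [integral_indicator (measurableSet_lt measurable_const hn)]
        simp [T]
      simp_rw [angularTail_eq_integral_indicator]
      rw [e, ← integral_finsetSum _ fun i _ => integrable_indicator_angular P _ _]
      refine integral_mono_ae ((integrable_const _).indicator (measurableSet_lt measurable_const hn))
        (integrable_finsetSum _ fun i _ => integrable_indicator_angular P _ _) ?_
      filter_upwards [hP] with v hv
      by_cases hv0 : y / l 0 < norm₁ v
      · have hn0 : 0 < norm₁ v := lt_trans (div_pos hy (hl0 0)) hv0
        rw [Set.indicator_of_mem (by exact hv0), ← hsum' v hv.1 hv.2 hn0]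
        refine Finset.sum_le_sum fun i _ => ?_
        rw [Set.indicator_of_mem]
        have := hl0 0
        exact lt_of_le_of_lt (div_le_div_of_nonneg_left hy.le (hl0 0)
          (hlmono.monotone (Nat.zero_le i))) hv0
      · rw [Set.indicator_of_notMem (by exact hv0)]
        exact Finset.sum_nonneg fun i _ => Set.indicator_nonneg (fun v _ => hf0 i _) _
    set A := ∑ i ∈ Finset.range J, (∫ v, f i v ∂S) * l i ^ β with hA
    have hlim1 : Tendsto (fun x => (∑ i ∈ Finset.range J, angularTail P (f i) (x / l i)) / T x)
        atTop (𝓝 A) := by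
      simp_rw [Finset.sum_div]
      exact tendsto_finsetSum _ fun i _ => tendsto_angularTail_div hL hT (hf (f i)) (hl0 i)
    have hlim2 : Tendsto (fun x => (∑ i ∈ Finset.range J,
        angularTail P (f i) (s⁻¹ * x / (s ^ 2 * l i))) / T x) atTop (𝓝 (s ^ (3 * β) * A)) := by
      simp_rw [Finset.sum_div, hA, Finset.mul_sum]
      refine tendsto_finsetSum _ fun i _ => ?_
      have h1 := tendsto_angularTail_div hL hT (hf (f i))
        (show 0 < s ^ 3 * l i by have := hl0 i; positivity)
      have e1 : (s ^ 3 * l i) ^ β = s ^ (3 * β) * l i ^ β := by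
        rw [Real.mul_rpow (by positivity) (hl0 i).le, Real.rpow_mul hs0.le]
        norm_num
      rw [e1, mul_left_comm (∫ v, f i v ∂S)] at h1
      refine h1.congr fun x => ?_
      have := hl0 i
      congr 2
      field_simp
    -- The limit must be positive for the ratio to be controlled; comparison with the tail of the
    -- norm gives A ≥ (l 0)^β.
    have hApos : 0 < A := by
      refine lt_of_lt_of_le (Real.rpow_pos_of_pos (hl0 0) β)
        (le_of_tendsto_of_tendsto (tendsto_tail_div_of_isSlowlyVarying hL hT (hl0 0)) hlim1 ?_)
      filter_upwards [hTpos, eventually_gt_atTop 0] with x hx hx0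
      exact div_le_div_of_nonneg_right (hlower' x hx0) hx.le
    have hlim3 := hlim2.eventually_lt (hlim1.const_mul (1 + ε))
      (mul_lt_mul_of_pos_right hsε hApos)
    filter_upwards [hlim3, hTpos, eventually_gt_atTop 0] with x hx hTx hx0
    rw [← mul_div_assoc, div_lt_div_iff_of_pos_right hTx] at hx
    have hε : 0 < 1 + ε := (Real.rpow_pos_of_pos hs0 _).trans hsε
    exact (hupper _ (by positivity)).trans (hx.le.trans
      (mul_le_mul_of_nonneg_left (hlower x hx0) hε.le))
  refine ⟨fun x => ?_, fun ε hε => ?_⟩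
  · obtain ⟨y, hy, hyx, hy0⟩ := (hTpos.and ((eventually_ge_atTop (x / a)).and
      (eventually_gt_atTop 0))).exists
    refine hy.trans_le (ENNReal.toReal_mono (measure_ne_top _ _) (measure_mono_ae ?_))
    filter_upwards [hP] with v hv hvy
    have hvy' : y < norm₁ v := hvy
    have := (hgab v hv.1 hv.2).1
    rw [div_le_iff₀ ha0] at hyx
    change x < g v
    nlinarith
  · have hcont : Tendsto (fun s : ℝ => s ^ (3 * β)) (𝓝[>] 1) (𝓝 1) := by
      have : ContinuousAt (fun s : ℝ => s ^ (3 * β)) 1 :=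
        Real.continuousAt_rpow_const 1 _ (Or.inl one_ne_zero)
      have h := this.tendsto
      simp only [Real.one_rpow] at h
      exact h.mono_left nhdsWithin_le_nhds
    obtain ⟨s, hs1, hs2⟩ := ((hcont.eventually_lt_const (show (1 : ℝ) < 1 + ε by linarith)).and
      self_mem_nhdsWithin).exists
    have hs2' : 1 < s := hs2
    exact ⟨s⁻¹, by positivity, inv_lt_one_of_one_lt₀ hs2', key s hs2' ε hs1⟩

end Angular

theorem conditionC_of_isMRV {μ : Measure Ω} [IsProbabilityMeasure μ] {Q : Ω → ℝ} {N : Ω → ℕ}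
    (hQ : Measurable Q) (hN : Measurable N) (hQ0 : ∀ᵐ ω ∂μ, 0 ≤ Q ω)
    (h : IsMRV (μ.map fun ω => (Q ω, (N ω : ℝ)))) : ConditionC μ Q N := by
  refine ⟨1, one_pos, fun c _ hc => ?_⟩
  have hm : Measurable fun ω => (Q ω, (N ω : ℝ)) := by fun_prop
  have := Measure.isProbabilityMeasure_map (μ := μ) hm.aemeasurable
  have h1 := h.isIRVTail ?_ hc
  · rw [isIRV_map_iff (by fun_prop)]
    convert h1 using 2 with x
    rw [map_measureReal_apply hm (measurableSet_lt measurable_const (by fun_prop))]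
    rfl
  · rw [ae_map_iff hm.aemeasurable]
    · filter_upwards [hQ0] with ω hω
      exact ⟨hω, Nat.cast_nonneg _⟩
    · exact (measurableSet_le measurable_const measurable_fst).inter
        (measurableSet_le measurable_const measurable_snd)

end Sufficient

/-! ### Existence, uniqueness and mean of the solution -/

section Law

variable {Ω : Type*} [MeasurableSpace Ω]

/-- The law of an i.i.d. sequence. -/
noncomputable abbrev iidLaw (ν : Measure ℝ) : Measure (ℕ → ℝ) :=
  Measure.infinitePi fun _ : ℕ => ν

theorem iIndepFun_eval (ν : Measure ℝ) [IsProbabilityMeasure ν] :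
    iIndepFun (fun (i : ℕ) (r : ℕ → ℝ) => r i) (iidLaw ν) :=
  iIndepFun_infinitePi (X := fun _ x => x) fun _ => measurable_id

theorem measurePreserving_eval_iidLaw (ν : Measure ℝ) [IsProbabilityMeasure ν] (i : ℕ) :
    MeasurePreserving (fun r : ℕ → ℝ => r i) (iidLaw ν) ν :=
  measurePreserving_eval_infinitePi (fun _ : ℕ => ν) i

theorem ae_iidLaw_nonneg {ν : Measure ℝ} [IsProbabilityMeasure ν] (hν : ∀ᵐ x ∂ν, 0 ≤ x) :
    ∀ᵐ r ∂iidLaw ν, ∀ i, 0 ≤ r i :=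
  ae_all_iff.2 fun i => (measurePreserving_eval_iidLaw ν i).quasiMeasurePreserving.ae hν

theorem measurable_randomSum : Measurable fun z : (ℝ × ℕ) × (ℕ → ℝ) =>
    z.1.1 + ∑ m ∈ Finset.range z.1.2, z.2 m := by
  have h : Measurable fun z : ℕ × (ℕ → ℝ) => ∑ m ∈ Finset.range z.1, z.2 m :=
    measurable_from_prod_countable_right fun n =>
      Finset.measurable_fun_sum (Finset.range n) fun i _ => measurable_pi_apply i
  have h' : Measurable fun z : (ℝ × ℕ) × (ℕ → ℝ) => (z.1.2, z.2) := by fun_prop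
  exact measurable_fst.fst.add (h.comp h')

variable {μ : Measure Ω} [IsProbabilityMeasure μ] {Q : Ω → ℝ} {N : Ω → ℕ}

theorem isProbabilityMeasure_randomSumLaw (hQ : Measurable Q) (hN : Measurable N)
    (ν : Measure ℝ) [IsProbabilityMeasure ν] :
    IsProbabilityMeasure (randomSumLaw μ Q N ν) := by
  have := Measure.isProbabilityMeasure_map (μ := μ) (hQ.prodMk hN).aemeasurable
  exact Measure.isProbabilityMeasure_map measurable_randomSum.aemeasurable

theorem lintegral_randomSumLaw (hQ : Measurable Q) (hN : Measurable N) (ν : Measure ℝ)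
    [IsProbabilityMeasure ν] {f : ℝ → ℝ≥0∞} (hf : Measurable f) :
    ∫⁻ x, f x ∂randomSumLaw μ Q N ν =
      ∫⁻ ω, ∫⁻ r, f (Q ω + ∑ m ∈ Finset.range (N ω), r m) ∂iidLaw ν ∂μ := by
  have := Measure.isProbabilityMeasure_map (μ := μ) (hQ.prodMk hN).aemeasurable
  have hm : Measurable fun z : (ℝ × ℕ) × (ℕ → ℝ) =>
      f (z.1.1 + ∑ m ∈ Finset.range z.1.2, z.2 m) := hf.comp measurable_randomSum
  rw [randomSumLaw, lintegral_map hf measurable_randomSum, lintegral_prod _ hm.aemeasurable,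
    lintegral_map hm.lintegral_prod_right' (hQ.prodMk hN)]

theorem ae_nonneg_randomSumLaw (hQ : Measurable Q) (hN : Measurable N)
    (hQ0 : ∀ᵐ ω ∂μ, 0 ≤ Q ω) {ν : Measure ℝ} [IsProbabilityMeasure ν] (hν : ∀ᵐ x ∂ν, 0 ≤ x) :
    ∀ᵐ x ∂randomSumLaw μ Q N ν, 0 ≤ x := by
  have h := lintegral_randomSumLaw (μ := μ) hQ hN ν
    (f := Set.indicator (Set.Iio 0) 1) (measurable_one.indicator measurableSet_Iio)
  rw [lintegral_indicator_one measurableSet_Iio] at h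
  have h0 : ∫⁻ ω, ∫⁻ r, Set.indicator (Set.Iio (0 : ℝ)) (1 : ℝ → ℝ≥0∞)
      (Q ω + ∑ m ∈ Finset.range (N ω), r m) ∂iidLaw ν ∂μ = ∫⁻ ω, 0 ∂μ := by
    refine lintegral_congr_ae ?_
    filter_upwards [hQ0] with ω hω
    rw [← lintegral_zero (μ := iidLaw ν)]
    refine lintegral_congr_ae ?_
    filter_upwards [ae_iidLaw_nonneg hν] with r hr
    refine Set.indicator_of_notMem ?_ _
    simpa using add_nonneg hω (Finset.sum_nonneg fun i _ => hr i)
  rw [h0, lintegral_zero] at h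
  rw [ae_iff]
  simpa [Set.Iio] using h

theorem lintegral_ofReal_sum {ν : Measure ℝ} [IsProbabilityMeasure ν] (hν : ∀ᵐ x ∂ν, 0 ≤ x)
    (n : ℕ) : ∫⁻ r, ENNReal.ofReal (∑ m ∈ Finset.range n, r m) ∂iidLaw ν =
      n * ∫⁻ x, ENNReal.ofReal x ∂ν := by
  have h : ∀ᵐ r ∂iidLaw ν, ENNReal.ofReal (∑ m ∈ Finset.range n, r m) =
      ∑ m ∈ Finset.range n, ENNReal.ofReal (r m) := by
    filter_upwards [ae_iidLaw_nonneg hν] with r hr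
    exact ENNReal.ofReal_sum_of_nonneg fun i _ => hr i
  rw [lintegral_congr_ae h, lintegral_finsetSum _ fun i _ => by fun_prop]
  have h' : ∀ i, ∫⁻ r, ENNReal.ofReal (r i) ∂iidLaw ν = ∫⁻ x, ENNReal.ofReal x ∂ν := fun i =>
    (measurePreserving_eval_iidLaw ν i).lintegral_comp ENNReal.measurable_ofReal
  simp [h']

theorem lintegral_ofReal_randomSumLaw (hQ : Measurable Q) (hN : Measurable N)
    (hQ0 : ∀ᵐ ω ∂μ, 0 ≤ Q ω) {ν : Measure ℝ} [IsProbabilityMeasure ν] (hν : ∀ᵐ x ∂ν, 0 ≤ x) :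
    ∫⁻ x, ENNReal.ofReal x ∂randomSumLaw μ Q N ν =
      ∫⁻ ω, ENNReal.ofReal (Q ω) ∂μ +
        (∫⁻ ω, ENNReal.ofReal (N ω) ∂μ) * ∫⁻ x, ENNReal.ofReal x ∂ν := by
  rw [lintegral_randomSumLaw hQ hN ν ENNReal.measurable_ofReal,
    ← lintegral_mul_const _ (by fun_prop), ← lintegral_add_left (by fun_prop)]
  refine lintegral_congr_ae ?_
  filter_upwards [hQ0] with ω hω
  have h : ∀ᵐ r ∂iidLaw ν, ENNReal.ofReal (Q ω + ∑ m ∈ Finset.range (N ω), r m) =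
      ENNReal.ofReal (Q ω) + ENNReal.ofReal (∑ m ∈ Finset.range (N ω), r m) := by
    filter_upwards [ae_iidLaw_nonneg hν] with r hr
    exact ENNReal.ofReal_add hω (Finset.sum_nonneg fun i _ => hr i)
  rw [lintegral_congr_ae h, lintegral_add_left measurable_const, lintegral_ofReal_sum hν]
  simp

theorem charFun_randomSumLaw (hQ : Measurable Q) (hN : Measurable N) (ν : Measure ℝ)
    [IsProbabilityMeasure ν] (t : ℝ) :
    charFun (randomSumLaw μ Q N ν) t =
      ∫ ω, Complex.exp (t * Q ω * Complex.I) * charFun ν t ^ N ω ∂μ := by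
  have := Measure.isProbabilityMeasure_map (μ := μ) (hQ.prodMk hN).aemeasurable
  have hmf : Measurable fun x : ℝ => Complex.exp (t * x * Complex.I) := by fun_prop
  have hm : Measurable fun z : (ℝ × ℕ) × (ℕ → ℝ) => Complex.exp
      (t * ((z.1.1 + ∑ m ∈ Finset.range z.1.2, z.2 m : ℝ) : ℂ) * Complex.I) :=
    hmf.comp measurable_randomSum
  rw [charFun_apply_real, randomSumLaw,
    integral_map measurable_randomSum.aemeasurable hmf.aestronglyMeasurable,
    integral_prod]
  · rw [integral_map (hQ.prodMk hN).aemeasurable]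
    · refine integral_congr_ae (.of_forall fun ω => ?_)
      have hsum : charFun ((iidLaw ν).map fun r => ∑ m ∈ Finset.range (N ω), r m) t =
          charFun ν t ^ N ω := by
        rw [iIndepFun.charFun_map_fun_finsetSum_eq_prod
          (X := fun (i : ℕ) (r : ℕ → ℝ) => r i) (fun i _ => (measurable_pi_apply i).aemeasurable)
          ((iIndepFun_eval ν).restrict _)]
        simp [(measurePreserving_eval_iidLaw ν _).map_eq]
      rw [charFun_apply_real, integral_map (by fun_prop) hmf.aestronglyMeasurable] at hsum
      beta_reduce
      rw [← hsum, ← integral_const_mul]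
      refine integral_congr_ae (.of_forall fun r => ?_)
      beta_reduce
      rw [← Complex.exp_add]
      push_cast
      ring_nf
    · exact (hm.stronglyMeasurable.integral_prod_right').aestronglyMeasurable
  · refine Integrable.of_bound hm.aestronglyMeasurable 1 (.of_forall fun z => ?_)
    rw [← Complex.ofReal_mul, Complex.norm_exp_ofReal_mul_I]

theorem norm_pow_sub_pow_le_nsmul {a b : ℂ} (ha : ‖a‖ ≤ 1) (hb : ‖b‖ ≤ 1) (n : ℕ) :
    ‖a ^ n - b ^ n‖ ≤ n * ‖a - b‖ := by
  induction n with
  | zero => simp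
  | succ n ih =>
    have e : a ^ (n + 1) - b ^ (n + 1) = a ^ n * (a - b) + (a ^ n - b ^ n) * b := by ring
    rw [e]
    refine (norm_add_le _ _).trans ?_
    rw [norm_mul, norm_mul, norm_pow]
    have h1 : ‖a‖ ^ n * ‖a - b‖ ≤ 1 * ‖a - b‖ := by
      gcongr
      exact pow_le_one₀ (norm_nonneg _) ha
    have h2 : ‖a ^ n - b ^ n‖ * ‖b‖ ≤ (n * ‖a - b‖) * 1 := by gcongr
    push_cast
    linarith

/-- The random sum operation contracts characteristic functions by the factor `E N`. -/
theorem norm_charFun_randomSumLaw_sub_le (hQ : Measurable Q) (hN : Measurable N)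
    (hNi : Integrable (fun ω => (N ω : ℝ)) μ) (ν ν' : Measure ℝ)
    [IsProbabilityMeasure ν] [IsProbabilityMeasure ν'] (t : ℝ) :
    ‖charFun (randomSumLaw μ Q N ν) t - charFun (randomSumLaw μ Q N ν') t‖ ≤
      (∫ ω, (N ω : ℝ) ∂μ) * ‖charFun ν t - charFun ν' t‖ := by
  have hnorm : ∀ ω, ‖Complex.exp (t * Q ω * Complex.I)‖ = 1 := fun ω => by
    rw [← Complex.ofReal_mul, Complex.norm_exp_ofReal_mul_I]
  have hint : ∀ (ρ : Measure ℝ) [IsProbabilityMeasure ρ],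
      Integrable (fun ω => Complex.exp (t * Q ω * Complex.I) * charFun ρ t ^ N ω) μ := by
    intro ρ _
    have hp : Measurable fun ω => charFun ρ t ^ N ω :=
      (measurable_from_nat (f := fun n : ℕ => charFun ρ t ^ n)).comp hN
    refine Integrable.of_bound (Measurable.aestronglyMeasurable (by fun_prop)) 1
      (.of_forall fun ω => ?_)
    rw [norm_mul, hnorm, one_mul, norm_pow]
    exact pow_le_one₀ (norm_nonneg _) (norm_charFun_le_one t)
  rw [charFun_randomSumLaw hQ hN, charFun_randomSumLaw hQ hN, ← integral_sub (hint ν) (hint ν'),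
    ← integral_mul_const]
  refine norm_integral_le_of_norm_le (hNi.mul_const _) (.of_forall fun ω => ?_)
  rw [← mul_sub, norm_mul, hnorm, one_mul]
  exact norm_pow_sub_pow_le_nsmul (norm_charFun_le_one t) (norm_charFun_le_one t) _

/-- For two fixed points the distance d of the characteristic functions at t satisfies d ≤ n̄ d, so
d = 0. -/
theorem IsNonnegSolution.eq (hQ : Measurable Q) (hN : Measurable N)
    (hNi : Integrable (fun ω => (N ω : ℝ)) μ) (hN1 : ∫ ω, (N ω : ℝ) ∂μ < 1)
    {ν ν' : ProbabilityMeasure ℝ} (h : IsNonnegSolution μ Q N ν)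
    (h' : IsNonnegSolution μ Q N ν') : ν = ν' := by
  refine Subtype.ext (Measure.ext_of_charFun
    (μ := (ν : Measure ℝ)) (ν := (ν' : Measure ℝ)) (funext fun t => ?_))
  have key := norm_charFun_randomSumLaw_sub_le hQ hN hNi (ν : Measure ℝ) (ν' : Measure ℝ) t
  rw [h.2, h'.2] at key
  have h0 := norm_nonneg (charFun (ν : Measure ℝ) t - charFun (ν' : Measure ℝ) t)
  exact sub_eq_zero.1 (norm_eq_zero.1 (by nlinarith))

theorem IsNonnegSolution.integral_eq (hQ : Measurable Q) (hN : Measurable N)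
    (hQ0 : ∀ᵐ ω ∂μ, 0 ≤ Q ω) (hQi : Integrable Q μ)
    (hNi : Integrable (fun ω => (N ω : ℝ)) μ) (hN1 : ∫ ω, (N ω : ℝ) ∂μ < 1)
    {ν : ProbabilityMeasure ℝ} (h : IsNonnegSolution μ Q N ν) (hm : HasFiniteMean ν) :
    ∫ x, x ∂(ν : Measure ℝ) = rBar μ Q N := by
  have h1 := lintegral_ofReal_randomSumLaw hQ hN hQ0 h.1
  have hN0 : 0 ≤ ∫ ω, (N ω : ℝ) ∂μ := integral_nonneg fun ω => Nat.cast_nonneg _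
  have hm0 : 0 ≤ ∫ x, x ∂(ν : Measure ℝ) := integral_nonneg_of_ae h.1
  rw [h.2, ← ofReal_integral_eq_lintegral_ofReal hm h.1,
    ← ofReal_integral_eq_lintegral_ofReal hQi hQ0,
    ← ofReal_integral_eq_lintegral_ofReal hNi (.of_forall fun ω => Nat.cast_nonneg _),
    ← ENNReal.ofReal_mul hN0, ← ENNReal.ofReal_add (integral_nonneg_of_ae hQ0)
      (mul_nonneg hN0 hm0), ENNReal.ofReal_eq_ofReal_iff hm0
      (add_nonneg (integral_nonneg_of_ae hQ0) (mul_nonneg hN0 hm0))] at h1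
  rw [rBar, eq_div_iff (by linarith)]
  linarith

/-- The laws obtained by iterating the random sum operation on the point mass at `0`. -/
noncomputable def iterLaw (μ : Measure Ω) (Q : Ω → ℝ) (N : Ω → ℕ) : ℕ → Measure ℝ
  | 0 => Measure.dirac 0
  | k + 1 => randomSumLaw μ Q N (iterLaw μ Q N k)

theorem isProbabilityMeasure_iterLaw (hQ : Measurable Q) (hN : Measurable N) (k : ℕ) :
    IsProbabilityMeasure (iterLaw μ Q N k) := by
  induction k with
  | zero => exact Measure.dirac.isProbabilityMeasure
  | succ k ih => exact isProbabilityMeasure_randomSumLaw hQ hN _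

theorem ae_nonneg_iterLaw (hQ : Measurable Q) (hN : Measurable N) (hQ0 : ∀ᵐ ω ∂μ, 0 ≤ Q ω)
    (k : ℕ) : ∀ᵐ x ∂iterLaw μ Q N k, 0 ≤ x := by
  induction k with
  | zero => simp [iterLaw]
  | succ k ih =>
    have := isProbabilityMeasure_iterLaw (μ := μ) hQ hN k
    exact ae_nonneg_randomSumLaw hQ hN hQ0 ih

/-- The means evolve by m ↦ q̄ + n̄ m, an increasing map with fixed point r̄, and start at 0 ≤ r̄.
-/
theorem lintegral_iterLaw_le (hQ : Measurable Q) (hN : Measurable N) (hQ0 : ∀ᵐ ω ∂μ, 0 ≤ Q ω)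
    (hQi : Integrable Q μ) (hNi : Integrable (fun ω => (N ω : ℝ)) μ)
    (hN1 : ∫ ω, (N ω : ℝ) ∂μ < 1) (k : ℕ) :
    ∫⁻ x, ENNReal.ofReal x ∂iterLaw μ Q N k ≤ ENNReal.ofReal (rBar μ Q N) := by
  have hN0 : 0 ≤ ∫ ω, (N ω : ℝ) ∂μ := integral_nonneg fun ω => Nat.cast_nonneg _
  have hq0 : 0 ≤ ∫ ω, Q ω ∂μ := integral_nonneg_of_ae hQ0
  have hr0 : 0 ≤ rBar μ Q N := div_nonneg hq0 (by linarith)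
  have hr : ∫ ω, Q ω ∂μ + (∫ ω, (N ω : ℝ) ∂μ) * rBar μ Q N = rBar μ Q N := by
    have : rBar μ Q N * (1 - ∫ ω, (N ω : ℝ) ∂μ) = ∫ ω, Q ω ∂μ :=
      div_mul_cancel₀ _ (by linarith)
    linarith
  induction k with
  | zero => simp [iterLaw]
  | succ k ih =>
    have := isProbabilityMeasure_iterLaw (μ := μ) hQ hN k
    rw [iterLaw, lintegral_ofReal_randomSumLaw hQ hN hQ0 (ae_nonneg_iterLaw hQ hN hQ0 k),
      ← ofReal_integral_eq_lintegral_ofReal hQi hQ0,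
      ← ofReal_integral_eq_lintegral_ofReal hNi (.of_forall fun ω => Nat.cast_nonneg _)]
    refine (add_le_add_right (mul_le_mul_right ih _) _).trans ?_
    rw [← ENNReal.ofReal_mul hN0, ← ENNReal.ofReal_add hq0 (mul_nonneg hN0 hr0), hr]

theorem exists_isNonnegSolution (hQ : Measurable Q) (hN : Measurable N)
    (hQ0 : ∀ᵐ ω ∂μ, 0 ≤ Q ω) (hQi : Integrable Q μ)
    (hNi : Integrable (fun ω => (N ω : ℝ)) μ) (hN1 : ∫ ω, (N ω : ℝ) ∂μ < 1) :
    ∃ ν : ProbabilityMeasure ℝ, IsNonnegSolution μ Q N ν ∧ HasFiniteMean ν := by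
  have hprob := isProbabilityMeasure_iterLaw (μ := μ) hQ hN
  set n' := ∫ ω, (N ω : ℝ) ∂μ with hn'
  have hN0 : 0 ≤ n' := integral_nonneg fun ω => Nat.cast_nonneg _
  set φ : ℕ → ℝ → ℂ := fun k t => charFun (iterLaw μ Q N k) t with hφ
  have hstep : ∀ k t, ‖φ (k + 1) t - φ (k + 2) t‖ ≤ n' * ‖φ k t - φ (k + 1) t‖ := fun k t =>
    norm_charFun_randomSumLaw_sub_le hQ hN hNi (iterLaw μ Q N k) (iterLaw μ Q N (k + 1)) t
  have hdist : ∀ t k, dist (φ k t) (φ (k + 1) t) ≤ 2 * n' ^ k := by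
    intro t k
    rw [dist_eq_norm]
    induction k with
    | zero =>
      refine (norm_sub_le _ _).trans ?_
      have h1 : ‖φ 0 t‖ ≤ 1 := norm_charFun_le_one t
      have h2 : ‖φ (0 + 1) t‖ ≤ 1 := norm_charFun_le_one t
      simp only [pow_zero]
      linarith
    | succ k ih =>
      refine (hstep k t).trans ?_
      rw [pow_succ]
      nlinarith
  have hcau : ∀ t, CauchySeq fun k => φ k t := fun t =>
    cauchySeq_of_le_geometric n' 2 hN1 (hdist t)
  choose f hf using fun t => cauchySeq_tendsto_of_complete (hcau t)
  have hdf : ∀ t k, dist (φ k t) (f t) ≤ 2 * n' ^ k / (1 - n') := fun t k =>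
    dist_le_of_le_geometric_of_tendsto n' 2 hN1 (hdist t) (hf t) k
  have hunif : TendstoUniformly φ f atTop := by
    rw [Metric.tendstoUniformly_iff]
    intro ε hε
    have : Tendsto (fun k : ℕ => 2 * n' ^ k / (1 - n')) atTop (𝓝 (2 * 0 / (1 - n'))) :=
      ((tendsto_pow_atTop_nhds_zero_of_lt_one hN0 hN1).const_mul 2).div_const _
    rw [mul_zero, zero_div] at this
    filter_upwards [this.eventually_lt_const hε] with k hk t
    rw [dist_comm]
    exact (hdf t k).trans_lt hk
  have hfcont : Continuous f := hunif.continuous (.of_forall fun k => by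
    simp only [hφ]; fun_prop)
  -- Continuity of the limit at 0 gives tightness; a weak limit along a subsequence then has
  -- characteristic function f.
  have htight := isTightMeasureSet_of_tendsto_charFun hfcont.continuousAt hf
  set ν : ℕ → ProbabilityMeasure ℝ := fun k => ⟨iterLaw μ Q N k, hprob k⟩ with hν
  have hcomp : IsCompact (closure (Set.range ν)) := by
    refine isCompact_closure_of_isTightMeasureSet ?_
    convert htight using 1
    ext m
    exact Set.exists_range_iff
  obtain ⟨ν₀, -, ψ, hψ, hlim⟩ :=
    hcomp.tendsto_subseq fun k => subset_closure (Set.mem_range_self (f := ν) k)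
  have hchar : ∀ t, charFun (ν₀ : Measure ℝ) t = f t := fun t =>
    tendsto_nhds_unique (ProbabilityMeasure.tendsto_iff_tendsto_charFun.1 hlim t)
      ((hf t).comp hψ.tendsto_atTop)
  have hnonneg : ∀ᵐ x ∂(ν₀ : Measure ℝ), 0 ≤ x := by
    have h1 := ProbabilityMeasure.le_liminf_measure_open_of_tendsto hlim (isOpen_Iio (a := (0 : ℝ)))
    have h2 : ∀ k, ((ν ∘ ψ) k : Measure ℝ) (Set.Iio 0) = 0 := fun k => by
      have := ae_nonneg_iterLaw (μ := μ) hQ hN hQ0 (ψ k)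
      rw [ae_iff] at this
      simp only [not_le] at this
      exact this
    simp only [h2, liminf_const, nonpos_iff_eq_zero] at h1
    rw [ae_iff]
    simpa [Set.Iio] using h1
  refine ⟨ν₀, ⟨hnonneg, ?_⟩, ?_⟩
  · have := isProbabilityMeasure_randomSumLaw (μ := μ) hQ hN (ν₀ : Measure ℝ)
    refine Measure.ext_of_charFun (funext fun t => ?_)
    rw [hchar]
    have h1 : Tendsto (fun k => φ (k + 1) t) atTop
        (𝓝 (charFun (randomSumLaw μ Q N (ν₀ : Measure ℝ)) t)) := by
      rw [tendsto_iff_norm_sub_tendsto_zero]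
      have h2 : Tendsto (fun k => n' * ‖φ k t - f t‖) atTop (𝓝 (n' * 0)) :=
        (tendsto_iff_norm_sub_tendsto_zero.1 (hf t)).const_mul n'
      rw [mul_zero] at h2
      refine squeeze_zero (fun _ => norm_nonneg _) (fun k => ?_) h2
      rw [← hchar]
      exact norm_charFun_randomSumLaw_sub_le hQ hN hNi (iterLaw μ Q N k) (ν₀ : Measure ℝ) t
    exact tendsto_nhds_unique h1 ((tendsto_add_atTop_iff_nat 1).2 (hf t))
  · refine ⟨aestronglyMeasurable_id, ?_⟩
    -- Fatou for weak limits carries the uniform bound r̄ on the means over to the limit.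
    rw [hasFiniteIntegral_iff_norm]
    have h1 := lintegral_le_liminf_lintegral_of_forall_isOpen_measure_le_liminf_measure
      (μ := (ν₀ : Measure ℝ)) (μs := fun k => ((ν ∘ ψ) k : Measure ℝ)) (f := fun x : ℝ => ‖x‖)
      continuous_norm (fun x => norm_nonneg x)
      fun G hG => ProbabilityMeasure.le_liminf_measure_open_of_tendsto hlim hG
    refine h1.trans_lt (lt_of_le_of_lt ?_ (ENNReal.ofReal_lt_top (r := rBar μ Q N)))
    refine liminf_le_of_frequently_le' (Frequently.of_forall fun k => ?_)
    refine le_trans (le_of_eq ?_) (lintegral_iterLaw_le (μ := μ) hQ hN hQ0 hQi hNi hN1 (ψ k))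
    refine lintegral_congr_ae ?_
    filter_upwards [ae_nonneg_iterLaw (μ := μ) hQ hN hQ0 (ψ k)] with x hx
    rw [Real.norm_of_nonneg hx]

end Law

/-! ### Tails of sums of i.i.d. non-negative summands -/

section SumTail

variable {Ω : Type*} [MeasurableSpace Ω]

/-- The tail of the sum of `n` independent random variables with law `ν`. -/
noncomputable def sumTail (ν : Measure ℝ) (n : ℕ) (y : ℝ) : ℝ :=
  (iidLaw ν).real {r | y < ∑ m ∈ Finset.range n, r m}

variable {ν : Measure ℝ}

theorem sumTail_nonneg (n : ℕ) (y : ℝ) : 0 ≤ sumTail ν n y := measureReal_nonneg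

theorem measurable_partialSum (s : Finset ℕ) :
    Measurable fun r : ℕ → ℝ => ∑ m ∈ s, r m :=
  Finset.measurable_fun_sum s fun i _ => measurable_pi_apply i

variable [IsProbabilityMeasure ν]

theorem sumTail_le_one (n : ℕ) (y : ℝ) : sumTail ν n y ≤ 1 := measureReal_le_one

theorem antitone_sumTail (n : ℕ) : Antitone (sumTail ν n) := antitone_tail _ _

theorem measurable_sumTail : Measurable fun z : ℕ × ℝ => sumTail ν z.1 z.2 :=
  measurable_from_prod_countable_right fun n => (antitone_sumTail (ν := ν) n).measurable

theorem tendsto_tail_atTop (ρ : Measure Ω) [IsFiniteMeasure ρ] {X : Ω → ℝ} (hX : Measurable X) :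
    Tendsto (fun x : ℝ => ρ.real {ω | x < X ω}) atTop (𝓝 0) := by
  have h := tendsto_measure_iInter_atTop (μ := ρ) (s := fun x : ℝ => {ω | x < X ω})
    (fun x => (measurableSet_lt measurable_const hX).nullMeasurableSet)
    (fun _ _ h _ hω => lt_of_le_of_lt h hω) ⟨0, measure_ne_top _ _⟩
  have he : ⋂ x : ℝ, {ω | x < X ω} = ∅ := by
    refine Set.eq_empty_of_forall_notMem fun ω hω => ?_
    exact lt_irrefl (X ω) (Set.mem_iInter.1 hω (X ω))
  rw [he, measure_empty] at h
  exact (ENNReal.tendsto_toReal ENNReal.zero_ne_top).comp h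

theorem tendsto_sumTail_atTop (n : ℕ) : Tendsto (sumTail ν n) atTop (𝓝 0) :=
  tendsto_tail_atTop _ (measurable_partialSum _)

theorem measureReal_eval_gt (i : ℕ) (x : ℝ) :
    (iidLaw ν).real {r | x < r i} = ν.real (Set.Ioi x) :=
  (measurePreserving_eval_iidLaw ν i).measureReal_preimage measurableSet_Ioi.nullMeasurableSet

theorem randomSumLaw_real_Ioi {μ : Measure Ω} [IsProbabilityMeasure μ] {Q : Ω → ℝ} {N : Ω → ℕ}
    (hQ : Measurable Q) (hN : Measurable N) (x : ℝ) :
    (randomSumLaw μ Q N ν).real (Set.Ioi x) = ∫ ω, sumTail ν (N ω) (x - Q ω) ∂μ := by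
  have h := lintegral_randomSumLaw (μ := μ) hQ hN ν
    (f := Set.indicator (Set.Ioi x) 1) (measurable_one.indicator measurableSet_Ioi)
  rw [lintegral_indicator_one measurableSet_Ioi] at h
  have h' : ∀ ω, ∫⁻ r, Set.indicator (Set.Ioi x) (1 : ℝ → ℝ≥0∞)
      (Q ω + ∑ m ∈ Finset.range (N ω), r m) ∂iidLaw ν =
      ENNReal.ofReal (sumTail ν (N ω) (x - Q ω)) := by
    intro ω
    rw [sumTail, ofReal_measureReal, ← lintegral_indicator_one
      (measurableSet_lt measurable_const (measurable_partialSum _))]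
    refine lintegral_congr fun r => ?_
    simp only [Set.indicator_apply, Set.mem_Ioi, Set.mem_ofPred_eq, sub_lt_iff_lt_add']
    rfl
  simp_rw [h'] at h
  have hm : Measurable fun ω => sumTail ν (N ω) (x - Q ω) :=
    measurable_sumTail.comp (hN.prodMk (measurable_const.sub hQ))
  rw [measureReal_def, h, ← integral_eq_lintegral_of_nonneg_ae
    (.of_forall fun ω => sumTail_nonneg _ _) hm.aestronglyMeasurable]

/-- The principle of a single big jump: either some summand exceeds `u`, or some summand exceeds
`w` while the remaining ones add up to more than `y - u`, or all summands are at most `w`. -/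
theorem sumTail_le_split (hν : ∀ᵐ x ∂ν, 0 ≤ x) (n : ℕ) (y u w : ℝ) :
    sumTail ν n y ≤ n * ν.real (Set.Ioi u) + n * (ν.real (Set.Ioi w) * sumTail ν n (y - u)) +
      (iidLaw ν).real {r | y < ∑ m ∈ Finset.range n, r m ∧ ∀ m < n, r m ≤ w} := by
  have hsub : {r : ℕ → ℝ | y < ∑ m ∈ Finset.range n, r m} ⊆
      ((⋃ m ∈ Finset.range n, {r | u < r m}) ∪
        ⋃ m ∈ Finset.range n, ({r | y - u < ∑ j ∈ (Finset.range n).erase m, r j} ∩ {r | w < r m})) ∪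
      {r | y < ∑ m ∈ Finset.range n, r m ∧ ∀ m < n, r m ≤ w} := by
    intro r hr
    by_cases h1 : ∃ m < n, u < r m
    · obtain ⟨m, hm, hu⟩ := h1
      exact Or.inl (Or.inl (Set.mem_biUnion (Finset.mem_coe.2 (Finset.mem_range.2 hm)) hu))
    · push Not at h1
      by_cases h2 : ∃ m < n, w < r m
      · obtain ⟨m, hm, hw⟩ := h2
        refine Or.inl (Or.inr (Set.mem_biUnion (Finset.mem_coe.2 (Finset.mem_range.2 hm)) ⟨?_, hw⟩))
        have h3 : y < ∑ m ∈ Finset.range n, r m := hr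
        rw [← Finset.sum_erase_add _ _ (Finset.mem_range.2 hm)] at h3
        have := h1 m hm
        simp only [Set.mem_ofPred_eq]
        linarith
      · push Not at h2
        exact Or.inr ⟨hr, h2⟩
  -- The summand m is independent of the sum of the others, and by non-negativity that sum is at
  -- most the full one.
  have hsecond : ∀ m ∈ Finset.range n, (iidLaw ν).real
      ({r | y - u < ∑ j ∈ (Finset.range n).erase m, r j} ∩ {r | w < r m}) ≤
        ν.real (Set.Ioi w) * sumTail ν n (y - u) := by
    intro m hm
    have hind := (iIndepFun_eval ν).indepFun_finsetSum_of_notMem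
      (fun i => measurable_pi_apply i) (Finset.notMem_erase m (Finset.range n))
    have hsum : (∑ j ∈ (Finset.range n).erase m, fun r : ℕ → ℝ => r j) =
        fun r => ∑ j ∈ (Finset.range n).erase m, r j := by
      ext r
      simp
    rw [hsum] at hind
    have h := hind.measure_inter_preimage_eq_mul (Set.Ioi (y - u)) (Set.Ioi w)
      measurableSet_Ioi measurableSet_Ioi
    have h' : (iidLaw ν).real
        ({r | y - u < ∑ j ∈ (Finset.range n).erase m, r j} ∩ {r | w < r m}) =
        (iidLaw ν).real {r | y - u < ∑ j ∈ (Finset.range n).erase m, r j} *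
          (iidLaw ν).real {r | w < r m} := by
      rw [measureReal_def, measureReal_def, measureReal_def, ← ENNReal.toReal_mul]
      exact congrArg ENNReal.toReal h
    rw [h', measureReal_eval_gt, mul_comm]
    refine mul_le_mul_of_nonneg_left ?_ measureReal_nonneg
    refine ENNReal.toReal_mono (measure_ne_top _ _) (measure_mono_ae ?_)
    filter_upwards [ae_iidLaw_nonneg hν] with r hr h
    have h3 : y - u < ∑ j ∈ (Finset.range n).erase m, r j := h
    exact h3.trans_le (Finset.sum_le_sum_of_subset_of_nonneg (Finset.erase_subset _ _)
      fun i _ _ => hr i)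
  refine (measureReal_mono hsub).trans ((measureReal_union_le _ _).trans ?_)
  gcongr
  refine (measureReal_union_le _ _).trans (add_le_add ?_ ?_)
  · refine (measureReal_biUnion_finset_le _ _).trans ?_
    simp [measureReal_eval_gt]
  · refine (measureReal_biUnion_finset_le _ _).trans ((Finset.sum_le_sum hsecond).trans ?_)
    simp

/-- The probability that some summand is large. -/
theorem one_sub_pow_le_sumTail (hν : ∀ᵐ x ∂ν, 0 ≤ x) (n : ℕ) (x : ℝ) :
    1 - (1 - ν.real (Set.Ioi x)) ^ n ≤ sumTail ν n x := by
  have h1 : (iidLaw ν).real {r | x < ∑ m ∈ Finset.range n, r m}ᶜ ≤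
      (iidLaw ν).real (Set.pi (Finset.range n) fun _ => Set.Iic x) := by
    refine ENNReal.toReal_mono (measure_ne_top _ _) (measure_mono_ae ?_)
    filter_upwards [ae_iidLaw_nonneg hν] with r hr h i hi
    have h3 : ¬ x < ∑ m ∈ Finset.range n, r m := h
    exact (Finset.single_le_sum (fun i _ => hr i) hi).trans (not_lt.1 h3)
  have h2 : (iidLaw ν).real (Set.pi (Finset.range n) fun _ => Set.Iic x) =
      (1 - ν.real (Set.Ioi x)) ^ n := by
    rw [measureReal_def, Measure.infinitePi_pi _ fun _ _ => measurableSet_Iic, ENNReal.toReal_prod]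
    simp only [Finset.prod_const, Finset.card_range]
    rw [← measureReal_def, ← Set.compl_Ioi, probReal_compl_eq_one_sub measurableSet_Ioi]
  rw [probReal_compl_eq_one_sub (measurableSet_lt measurable_const (measurable_partialSum _)),
    h2] at h1
  change _ ≤ (iidLaw ν).real _
  linarith

theorem tendstoInMeasure_average (hi : Integrable (fun x : ℝ => x) ν) :
    TendstoInMeasure (iidLaw ν) (fun (n : ℕ) r => (∑ m ∈ Finset.range n, r m) / n) atTop
      fun _ => ∫ x, x ∂ν := by
  have hmp := measurePreserving_eval_iidLaw ν
  have hint : Integrable (fun r : ℕ → ℝ => r 0) (iidLaw ν) := (hmp 0).integrable_comp_of_integrable hi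
  have hmean : ∫ r, r 0 ∂iidLaw ν = ∫ x, x ∂ν := by
    have h := integral_map (hmp 0).measurable.aemeasurable
      (aestronglyMeasurable_id (α := ℝ) (μ := (iidLaw ν).map fun r => r 0))
    rw [(hmp 0).map_eq] at h
    exact h.symm
  have h := strong_law_ae_real (fun (i : ℕ) (r : ℕ → ℝ) => r i) hint
    (fun i j hij => (iIndepFun_eval ν).indepFun hij)
    fun i => ⟨(hmp i).measurable.aemeasurable, (hmp 0).measurable.aemeasurable,
      (hmp i).map_eq.trans (hmp 0).map_eq.symm⟩
  rw [hmean] at h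
  exact tendstoInMeasure_of_tendsto_ae
    (fun n => ((measurable_partialSum _).div_const _).aestronglyMeasurable) h

theorem tendsto_measureReal_abs_sum_sub (hi : Integrable (fun x : ℝ => x) ν) {δ : ℝ} (hδ : 0 < δ) :
    Tendsto (fun n : ℕ => (iidLaw ν).real
      {r | δ * n ≤ |∑ m ∈ Finset.range n, r m - (∫ x, x ∂ν) * n|}) atTop (𝓝 0) := by
  have h := (tendstoInMeasure_iff_measureReal_norm.1 (tendstoInMeasure_average hi)) δ hδ
  refine h.congr' ?_
  filter_upwards [eventually_gt_atTop 0] with n hn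
  have hn' : (0 : ℝ) < n := Nat.cast_pos.2 hn
  congr 1
  ext r
  simp only [Set.mem_ofPred_eq, Real.norm_eq_abs]
  have e : |∑ m ∈ Finset.range n, r m - (∫ x, x ∂ν) * n| =
      |(∑ m ∈ Finset.range n, r m) / n - ∫ x, x ∂ν| * n := by
    have e' : ∑ m ∈ Finset.range n, r m - (∫ x, x ∂ν) * n =
        ((∑ m ∈ Finset.range n, r m) / n - ∫ x, x ∂ν) * n := by
      rw [sub_mul, div_mul_cancel₀ _ hn'.ne']
    rw [e', abs_mul, abs_of_pos hn']
  rw [e, mul_le_mul_iff_left₀ hn']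

theorem tendsto_sumTail_add (hi : Integrable (fun x : ℝ => x) ν) {δ : ℝ} (hδ : 0 < δ) :
    Tendsto (fun n : ℕ => sumTail ν n ((∫ x, x ∂ν + δ) * n)) atTop (𝓝 0) := by
  refine squeeze_zero (fun n => sumTail_nonneg _ _) (fun n => measureReal_mono fun r hr => ?_)
    (tendsto_measureReal_abs_sum_sub hi hδ)
  have h : (∫ x, x ∂ν + δ) * n < ∑ m ∈ Finset.range n, r m := hr
  simp only [Set.mem_ofPred_eq]
  exact le_trans (by linarith) (le_abs_self _)

theorem tendsto_sumTail_sub (hi : Integrable (fun x : ℝ => x) ν) {δ : ℝ} (hδ : 0 < δ) :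
    Tendsto (fun n : ℕ => sumTail ν n ((∫ x, x ∂ν - δ) * n)) atTop (𝓝 1) := by
  have h := (tendsto_measureReal_abs_sum_sub hi hδ).const_sub 1
  rw [sub_zero] at h
  refine tendsto_of_tendsto_of_tendsto_of_le_of_le h tendsto_const_nhds (fun n => ?_)
    fun n => sumTail_le_one _ _
  have hm : MeasurableSet {r : ℕ → ℝ | (∫ x, x ∂ν - δ) * n < ∑ m ∈ Finset.range n, r m} :=
    measurableSet_lt measurable_const (measurable_partialSum _)
  rw [sumTail, ← compl_compl {r : ℕ → ℝ | _ < _}, probReal_compl_eq_one_sub hm.compl]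
  refine sub_le_sub_left (measureReal_mono fun r hr => ?_) 1
  have h : ¬ (∫ x, x ∂ν - δ) * n < ∑ m ∈ Finset.range n, r m := hr
  simp only [Set.mem_ofPred_eq]
  exact le_trans (by linarith) (neg_le_abs _)

/-- Exponential bound for the sum of summands that are bounded by `w`. -/
theorem measureReal_sum_gt_bounded_le (hν : ∀ᵐ x ∂ν, 0 ≤ x)
    (hi : Integrable (fun x : ℝ => x) ν) (n k : ℕ) {w A : ℝ} (hw : 0 < w) (hA : 1 ≤ A) :
    (iidLaw ν).real {r | k * w < ∑ m ∈ Finset.range n, r m ∧ ∀ m < n, r m ≤ w} ≤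
      (A ^ k)⁻¹ * Real.exp (n * (∫ x, x ∂ν) * A / w) := by
  have hA0 : 0 < A := by linarith
  -- Chernoff bound for the summands truncated at w, with s chosen so that exp(sw) = A.
  set s := Real.log A / w with hs
  have hs0 : 0 ≤ s := div_nonneg (Real.log_nonneg hA) hw.le
  have hsw : Real.exp (s * w) = A := by
    rw [hs, div_mul_cancel₀ _ hw.ne', Real.exp_log hA0]
  have hm0 : 0 ≤ ∫ x, x ∂ν := integral_nonneg_of_ae hν
  set X : ℕ → (ℕ → ℝ) → ℝ := fun i r => min (r i) w with hX
  have hXm : ∀ i, Measurable (X i) := fun i => (measurable_pi_apply i).min measurable_const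
  have hXi : iIndepFun X (iidLaw ν) :=
    iIndepFun_infinitePi (X := fun _ x => min x w) fun _ => measurable_id.min measurable_const
  -- On [0, w] the convex function exp(s·) lies below its chord, so a first moment controls the
  -- exponential moment.
  have hexp : ∀ x, 0 ≤ x → Real.exp (s * min x w) ≤ 1 + (A - 1) / w * x := by
    intro x hx
    have hu : 0 ≤ min x w := le_min hx hw.le
    have huw : min x w / w ≤ 1 := (div_le_one hw).2 (min_le_right _ _)
    have h := convexOn_exp.2 (Set.mem_univ (0 : ℝ)) (Set.mem_univ (s * w))
      (sub_nonneg.2 huw) (div_nonneg hu hw.le) (by ring)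
    have e : (1 - min x w / w) • (0 : ℝ) + (min x w / w) • (s * w) = s * min x w := by
      simp only [smul_eq_mul]
      field_simp
      ring
    rw [e, Real.exp_zero, hsw] at h
    simp only [smul_eq_mul] at h
    have h2 : min x w * ((A - 1) / w) ≤ x * ((A - 1) / w) :=
      mul_le_mul_of_nonneg_right (min_le_left _ _) (div_nonneg (by linarith) hw.le)
    calc Real.exp (s * min x w) ≤ (1 - min x w / w) * 1 + min x w / w * A := h
      _ = 1 + min x w * ((A - 1) / w) := by ring
      _ ≤ _ := by linarith
  have hmgf : ∀ i, mgf (X i) (iidLaw ν) s ≤ Real.exp ((∫ x, x ∂ν) * A / w) := by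
    intro i
    have h1 : mgf (X i) (iidLaw ν) s = ∫ x, Real.exp (s * min x w) ∂ν := by
      have h := integral_map (μ := iidLaw ν) (φ := fun r : ℕ → ℝ => r i)
        (f := fun x => Real.exp (s * min x w)) (measurable_pi_apply i).aemeasurable (by fun_prop)
      rw [(measurePreserving_eval_iidLaw ν i).map_eq] at h
      exact h.symm
    have h2 : ∫ x, Real.exp (s * min x w) ∂ν ≤ ∫ x, (1 + (A - 1) / w * x) ∂ν := by
      refine integral_mono_of_nonneg (.of_forall fun x => (Real.exp_pos _).le)
        ((integrable_const _).add (hi.const_mul _)) ?_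
      filter_upwards [hν] with x hx using hexp x hx
    rw [integral_add (integrable_const _) (hi.const_mul _), integral_const_mul] at h2
    simp only [integral_const, probReal_univ, smul_eq_mul, mul_one] at h2
    rw [h1]
    refine h2.trans (le_trans ?_ (Real.add_one_le_exp _))
    rw [add_comm, add_le_add_iff_right, div_mul_eq_mul_div, mul_comm (A - 1)]
    gcongr
    linarith
  have hint : Integrable (fun r => Real.exp (s * (∑ i ∈ Finset.range n, X i) r)) (iidLaw ν) := by
    have hSm : Measurable (∑ i ∈ Finset.range n, X i) := by
      have := Finset.measurable_fun_sum (Finset.range n) fun i _ => hXm i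
      convert this using 1
      ext r
      simp
    refine Integrable.of_bound (by fun_prop) (Real.exp (s * (n * w))) (.of_forall fun r => ?_)
    rw [Real.norm_of_nonneg (Real.exp_pos _).le, Finset.sum_apply]
    gcongr
    refine (Finset.sum_le_card_nsmul _ _ w fun i _ => min_le_right _ _).trans ?_
    simp
  have hch := measure_ge_le_exp_mul_mgf (μ := iidLaw ν) (X := ∑ i ∈ Finset.range n, X i)
    (k * w) hs0 hint
  rw [hXi.mgf_sum hXm] at hch
  have e1 : Real.exp (-s * (k * w)) = (A ^ k)⁻¹ := by
    rw [← hsw, ← Real.exp_nat_mul, ← Real.exp_neg]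
    ring_nf
  have e2 : ∏ i ∈ Finset.range n, mgf (X i) (iidLaw ν) s ≤
      Real.exp (n * (∫ x, x ∂ν) * A / w) := by
    refine (Finset.prod_le_prod (fun i _ => mgf_nonneg) fun i _ => hmgf i).trans ?_
    rw [Finset.prod_const, Finset.card_range, ← Real.exp_nat_mul]
    ring_nf
    rfl
  rw [e1] at hch
  refine (measureReal_mono fun r hr => ?_).trans (hch.trans (by gcongr))
  have h3 : ∑ m ∈ Finset.range n, X m r = ∑ m ∈ Finset.range n, r m :=
    Finset.sum_congr rfl fun i hi => min_eq_left (hr.2 i (Finset.mem_range.1 hi))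
  simp only [Set.mem_ofPred_eq, Finset.sum_apply, h3]
  exact hr.1.le

end SumTail

/-! ### One-step estimates given (Q, N) -/

section OneStep

variable {Ω : Type*} [MeasurableSpace Ω] {μ : Measure Ω}

theorem integral_indicator_tail (X : Ω → ℝ) (hX : Measurable X) (x : ℝ) :
    ∫ ω, Set.indicator {ω | x < X ω} (fun _ => (1 : ℝ)) ω ∂μ = μ.real {ω | x < X ω} := by
  rw [integral_indicator (measurableSet_lt measurable_const hX)]
  simp

section

variable {Q : Ω → ℝ} {N : Ω → ℕ} {ν : Measure ℝ} [IsProbabilityMeasure ν]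

/-- Dominated convergence with majorant N. This makes the event "one fairly large summand, and the
others still large" negligible. -/
theorem tendsto_integral_mul_sumTail (hQ : Measurable Q) (hN : Measurable N)
    (hNi : Integrable (fun ω => (N ω : ℝ)) μ) {a : ℝ} (ha : 0 < a) :
    Tendsto (fun x : ℝ => ∫ ω, (N ω : ℝ) * sumTail ν (N ω) (a * x - Q ω) ∂μ) atTop (𝓝 0) := by
  rw [← integral_zero Ω ℝ (μ := μ)]
  refine tendsto_integral_filter_of_dominated_convergence (fun ω => (N ω : ℝ))
    (.of_forall fun x => ?_) (.of_forall fun x => .of_forall fun ω => ?_) hNi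
    (.of_forall fun ω => ?_)
  · have h : Measurable fun ω => sumTail ν (N ω) (a * x - Q ω) :=
      measurable_sumTail.comp (hN.prodMk (measurable_const.sub hQ))
    exact (Measurable.mul (by fun_prop) h).aestronglyMeasurable
  · rw [Real.norm_of_nonneg (mul_nonneg (Nat.cast_nonneg _) (sumTail_nonneg _ _))]
    exact mul_le_of_le_one_right (Nat.cast_nonneg _) (sumTail_le_one _ _)
  · have h1 : Tendsto (fun x : ℝ => a * x - Q ω) atTop atTop :=
      tendsto_atTop_add_const_right _ _ (tendsto_id.const_mul_atTop ha)
    simpa using ((tendsto_sumTail_atTop (ν := ν) (N ω)).comp h1).const_mul (N ω : ℝ)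

theorem integrable_mul_sumTail (hQ : Measurable Q) (hN : Measurable N)
    (hNi : Integrable (fun ω => (N ω : ℝ)) μ) (y : ℝ) :
    Integrable (fun ω => (N ω : ℝ) * sumTail ν (N ω) (y - Q ω)) μ := by
  have h : Measurable fun ω => sumTail ν (N ω) (y - Q ω) :=
    measurable_sumTail.comp (hN.prodMk (measurable_const.sub hQ))
  refine hNi.mono' (Measurable.mul (by fun_prop) h).aestronglyMeasurable (.of_forall fun ω => ?_)
  rw [Real.norm_of_nonneg (mul_nonneg (Nat.cast_nonneg _) (sumTail_nonneg _ _))]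
  exact mul_le_of_le_one_right (Nat.cast_nonneg _) (sumTail_le_one _ _)

/-- The geometric sum is (1 - (1 - G)^N) / G when G > 0: the probability that some summand exceeds
x, relative to G. It increases to N as G → 0, and N dominates it. -/
theorem tendsto_integral_geom_sum (hQ : Measurable Q) (hN : Measurable N)
    (hNi : Integrable (fun ω => (N ω : ℝ)) μ) (r : ℝ) :
    Tendsto (fun x : ℝ => ∫ ω, Set.indicator {ω | Q ω + r * N ω ≤ x}
      (fun ω => ∑ j ∈ Finset.range (N ω), (1 - ν.real (Set.Ioi x)) ^ j) ω ∂μ) atTop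
      (𝓝 (∫ ω, (N ω : ℝ) ∂μ)) := by
  have hG0 : ∀ x, 0 ≤ 1 - ν.real (Set.Ioi x) := fun x => sub_nonneg.2 measureReal_le_one
  have hG1 : ∀ x, 1 - ν.real (Set.Ioi x) ≤ 1 := fun x => sub_le_self _ measureReal_nonneg
  have hgeom0 : ∀ (x : ℝ) (n : ℕ), 0 ≤ ∑ j ∈ Finset.range n, (1 - ν.real (Set.Ioi x)) ^ j :=
    fun x n => Finset.sum_nonneg fun j _ => pow_nonneg (hG0 x) j
  refine tendsto_integral_filter_of_dominated_convergence (fun ω => (N ω : ℝ))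
    (.of_forall fun x => ?_) (.of_forall fun x => .of_forall fun ω => ?_) hNi
    (.of_forall fun ω => ?_)
  · refine (Measurable.indicator ((measurable_from_nat (f := fun n : ℕ =>
      ∑ j ∈ Finset.range n, (1 - ν.real (Set.Ioi x)) ^ j)).comp hN) ?_).aestronglyMeasurable
    exact measurableSet_le (by fun_prop) measurable_const
  · rw [Real.norm_of_nonneg (Set.indicator_nonneg (fun _ _ => hgeom0 x _) _)]
    refine (Set.indicator_le_self' (fun _ _ => hgeom0 x _) _).trans ?_
    refine (Finset.sum_le_card_nsmul _ _ 1 fun j _ => pow_le_one₀ (hG0 x) (hG1 x)).trans ?_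
    simp
  · have hG : Tendsto (fun x : ℝ => ν.real (Set.Ioi x)) atTop (𝓝 0) :=
      tendsto_tail_atTop ν measurable_id
    have h1 : Tendsto (fun x : ℝ => ∑ j ∈ Finset.range (N ω), (1 - ν.real (Set.Ioi x)) ^ j) atTop
        (𝓝 (∑ j ∈ Finset.range (N ω), (1 - 0) ^ j)) :=
      tendsto_finsetSum _ fun j _ => (hG.const_sub 1).pow j
    simp only [sub_zero, one_pow, Finset.sum_const, Finset.card_range, nsmul_eq_mul, mul_one] at h1
    refine h1.congr' ?_
    filter_upwards [eventually_ge_atTop (Q ω + r * N ω)] with x hx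
    rw [Set.indicator_of_mem (by exact hx)]

end

variable [IsProbabilityMeasure μ]

/-- Truncated power of an integer-valued random variable, at scale `x`. -/
noncomputable def truncPow (k : ℕ) (x : ℝ) (n : ℕ) : ℝ :=
  if (n : ℝ) ≤ x then ((n : ℝ) / x) ^ k else 0

theorem truncPow_nonneg (k : ℕ) (x : ℝ) (n : ℕ) : 0 ≤ truncPow k x n := by
  unfold truncPow
  split_ifs with h
  · have : 0 ≤ x := (Nat.cast_nonneg n).trans h
    positivity
  · exact le_rfl

theorem truncPow_le_one (k : ℕ) (x : ℝ) (n : ℕ) : truncPow k x n ≤ 1 := by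
  unfold truncPow
  split_ifs with h
  · have hx : 0 ≤ x := (Nat.cast_nonneg n).trans h
    exact pow_le_one₀ (by positivity) (div_le_one_of_le₀ h hx)
  · exact zero_le_one

theorem integrable_comp_of_bounded {N : Ω → ℕ} (hN : Measurable N) {f : ℕ → ℝ} {C : ℝ}
    (hf : ∀ n, |f n| ≤ C) : Integrable (fun ω => f (N ω)) μ :=
  Integrable.of_bound ((measurable_from_nat (f := f)).comp hN).aestronglyMeasurable C
    (.of_forall fun _ => hf _)

theorem integrable_truncPow {N : Ω → ℕ} (hN : Measurable N) (k : ℕ) (x : ℝ) :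
    Integrable (fun ω => truncPow k x (N ω)) μ :=
  integrable_comp_of_bounded hN (C := 1) fun n => by
    rw [abs_of_nonneg (truncPow_nonneg _ _ _)]
    exact truncPow_le_one _ _ _

theorem integrable_indicator_tail (X : Ω → ℝ) (hX : Measurable X) (x : ℝ) :
    Integrable (Set.indicator {ω | x < X ω} fun _ => (1 : ℝ)) μ :=
  (integrable_const _).indicator (measurableSet_lt measurable_const hX)

/-- Truncated moments of high order are dominated by a tail of dominated variation. -/
theorem exists_truncPow_integral_le {N : Ω → ℕ} (hN : Measurable N) {F : ℝ → ℝ}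
    (hF : IsIRVTail F) (hFa : Antitone F) {r : ℝ} (hr : 0 < r)
    (hNF : ∀ x, 0 < x → μ.real {ω | x < (N ω : ℝ)} ≤ F (r * x)) :
    ∃ k : ℕ, 0 < k ∧ ∀ ε : ℝ, 0 < ε → ∃ κ : ℝ, 0 < κ ∧ κ ≤ 1 ∧ ∀ᶠ x in atTop,
      κ ^ k * ∫ ω, truncPow k (κ * x) (N ω) ∂μ ≤ ε * F x := by
  obtain ⟨D, hD1, hD⟩ := hF.exists_le_mul hFa (show (0 : ℝ) < 1 / 2 by norm_num)
  obtain ⟨D', hD'1, hD'⟩ := hF.exists_le_mul hFa (show (0 : ℝ) < r / 2 by positivity)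
  have hD0 : 0 < D := by linarith
  -- Halving x costs a factor D in F but gains 2^k in the truncated moment; this k makes the ratio
  -- at most 1/2.
  obtain ⟨k, hk⟩ := pow_unbounded_of_one_lt (2 * D) (one_lt_two (α := ℝ))
  have hk0 : 0 < k := by
    rcases Nat.eq_zero_or_pos k with h | h
    · rw [h, pow_zero] at hk
      linarith
    · exact h
  have hkD : D / 2 ^ k ≤ 1 / 2 := by
    rw [div_le_iff₀ (by positivity)]
    linarith
  set H : ℝ → ℝ := fun x => ∫ ω, truncPow k x (N ω) ∂μ with hH
  have hH1 : ∀ x, H x ≤ 1 := fun x => by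
    refine (integral_mono (integrable_truncPow hN k x) (integrable_const 1)
      fun ω => truncPow_le_one _ _ _).trans ?_
    simp
  -- Split at N = x / 2: above it the truncated power is at most 1, below it equals 2^(-k) times the
  -- one at scale x / 2.
  have hHrec : ∀ x, 0 < x → H x ≤ F (r / 2 * x) + H (1 / 2 * x) / 2 ^ k := by
    intro x hx
    have hx2 : 0 < 1 / 2 * x := by positivity
    have h1 := hNF _ hx2
    rw [← integral_indicator_tail _ (by fun_prop)] at h1
    have e : r * (1 / 2 * x) = r / 2 * x := by ring
    rw [e] at h1
    refine le_trans ?_ (add_le_add_left h1 _)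
    rw [hH, ← integral_div, ← integral_add (integrable_indicator_tail _ (by fun_prop) _)
      ((integrable_truncPow hN k _).div_const _)]
    refine integral_mono (integrable_truncPow hN k x)
      ((integrable_indicator_tail _ (by fun_prop) _).add
        ((integrable_truncPow hN k _).div_const _)) fun ω => ?_
    by_cases hω : 1 / 2 * x < (N ω : ℝ)
    · beta_reduce
      rw [Set.indicator_of_mem (by exact hω)]
      have h2 := truncPow_le_one k x (N ω)
      have h3 : 0 ≤ truncPow k (1 / 2 * x) (N ω) / 2 ^ k :=
        div_nonneg (truncPow_nonneg _ _ _) (by positivity)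
      linarith
    · beta_reduce
      rw [Set.indicator_of_notMem (by exact hω), zero_add, truncPow, truncPow,
        if_pos (by linarith), if_pos (not_lt.1 hω), ← div_pow]
      refine le_of_eq ?_
      congr 1
      field_simp
  obtain ⟨x₀, hx₀⟩ := eventually_atTop.1 (hD.and hD')
  obtain ⟨K, hK⟩ := exists_forall_le_of_recursive (h := fun x => H x / F x) (C := D')
    (θ := 1 / 2) (ρ := 1 / 2) (x₀ := max x₀ 1) (by norm_num) (by norm_num) (by norm_num)
    (fun x => ⟨1 / F x, fun y hy => div_le_div₀ zero_le_one (hH1 y) (hF.1 x) (hFa hy)⟩)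
    (by
      intro x hx K hK0 hKy
      have hx1 : 0 < x := lt_of_lt_of_le one_pos ((le_max_right _ _).trans hx)
      obtain ⟨h1, h2⟩ := hx₀ x ((le_max_left _ _).trans hx)
      have h3 := hKy (1 / 2 * x) le_rfl
      rw [div_le_iff₀ (hF.1 _)] at h3
      rw [div_le_iff₀ (hF.1 _)]
      calc H x ≤ F (r / 2 * x) + H (1 / 2 * x) / 2 ^ k := hHrec x hx1
        _ ≤ D' * F x + K * (D * F x) / 2 ^ k := by
          gcongr
          exact h3.trans (by gcongr)
        _ = D' * F x + K * F x * (D / 2 ^ k) := by ring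
        _ ≤ D' * F x + K * F x * (1 / 2) := by
          have := hF.1 x
          gcongr
        _ = _ := by ring)
  have hK' : ∀ x, H x ≤ max K 0 * F x := fun x =>
    ((div_le_iff₀ (hF.1 x)).1 (hK x)).trans (by have := hF.1 x; gcongr; exact le_max_left _ _)
  have hiter : ∀ j : ℕ, ∀ᶠ x in atTop, F ((1 / 2) ^ j * x) ≤ D ^ j * F x := by
    intro j
    induction j with
    | zero => simp
    | succ j ih =>
      filter_upwards [ih, (tendsto_id.const_mul_atTop
        (pow_pos (show (0 : ℝ) < 1 / 2 by norm_num) j)).eventually hD] with x h1 h2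
      simp only [id] at h2
      calc F ((1 / 2) ^ (j + 1) * x) = F (1 / 2 * ((1 / 2) ^ j * x)) := by congr 1; ring
        _ ≤ D * (D ^ j * F x) := h2.trans (by gcongr)
        _ = _ := by ring
  refine ⟨k, hk0, fun ε hε => ?_⟩
  have hlim : Tendsto (fun j : ℕ => max K 0 * (1 / 2 : ℝ) ^ j) atTop (𝓝 (max K 0 * 0)) :=
    (tendsto_pow_atTop_nhds_zero_of_lt_one (by norm_num) (by norm_num)).const_mul _
  rw [mul_zero] at hlim
  obtain ⟨j, hj⟩ := (hlim.eventually_lt_const hε).exists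
  -- With κ = 2^(-j), the bound H ≤ max K 0 · F gives κ^k H(κx) ≤ max K 0 · (D / 2^k)^j F(x), small
  -- for large j.
  refine ⟨(1 / 2) ^ j, by positivity, pow_le_one₀ (by norm_num) (by norm_num), ?_⟩
  filter_upwards [hiter j] with x hx
  have hm : 0 ≤ max K 0 := le_max_right _ _
  have hFx := hF.1 x
  calc ((1 / 2 : ℝ) ^ j) ^ k * H ((1 / 2) ^ j * x)
      ≤ ((1 / 2 : ℝ) ^ j) ^ k * (max K 0 * (D ^ j * F x)) := by
        gcongr
        exact (hK' _).trans (by gcongr)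
    _ = max K 0 * (D / 2 ^ k) ^ j * F x := by
        rw [pow_right_comm, div_eq_mul_inv D, ← inv_pow, ← one_div, mul_pow]
        ring
    _ ≤ max K 0 * (1 / 2) ^ j * F x := by gcongr
    _ ≤ ε * F x := by gcongr

variable {Q : Ω → ℝ} {N : Ω → ℕ} {ν : Measure ℝ} [IsProbabilityMeasure ν]

theorem integrable_sumTail (hQ : Measurable Q) (hN : Measurable N) (y : ℝ) :
    Integrable (fun ω => sumTail ν (N ω) (y - Q ω)) μ := by
  have h : Measurable fun ω => sumTail ν (N ω) (y - Q ω) :=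
    measurable_sumTail.comp (hN.prodMk (measurable_const.sub hQ))
  refine Integrable.of_bound h.aestronglyMeasurable 1 (.of_forall fun ω => ?_)
  rw [Real.norm_of_nonneg (sumTail_nonneg _ _)]
  exact sumTail_le_one _ _

/-- Upper bound for the probability that a random sum is large, given the number of summands. -/
theorem sumTail_sub_le (hν : ∀ᵐ x ∂ν, 0 ≤ x) (hi : Integrable (fun x : ℝ => x) ν)
    {k : ℕ} (hk : 0 < k) {δ α κ ε x q : ℝ} (hδ : 0 < δ) (hκ0 : 0 < κ) (hκ1 : κ ≤ 1) (hε : 0 ≤ ε)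
    (hx : 0 < x) (n : ℕ) (hw : κ * x < n → sumTail ν n ((∫ x, x ∂ν + δ) * n) ≤ ε) :
    sumTail ν n (x - q) ≤
      Set.indicator {p : ℝ × ℕ | (1 - δ) * x < p.1 + (∫ x, x ∂ν + δ) * p.2} (fun _ => 1) (q, n) +
      n * ν.real (Set.Ioi (α * x)) +
      ν.real (Set.Ioi (δ / k * x)) * (n * sumTail ν n ((1 - α) * x - q)) +
      ε * Set.indicator {m : ℕ | κ * x < m} (fun _ => 1) n +
      Real.exp ((∫ x, x ∂ν) * k / δ) * (κ ^ k * truncPow k (κ * x) n) := by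
  have hk' : (0 : ℝ) < k := Nat.cast_pos.2 hk
  have h2 : 0 ≤ n * ν.real (Set.Ioi (α * x)) := by positivity
  have h3 : 0 ≤ ν.real (Set.Ioi (δ / k * x)) * (n * sumTail ν n ((1 - α) * x - q)) :=
    mul_nonneg measureReal_nonneg (mul_nonneg (Nat.cast_nonneg _) (sumTail_nonneg _ _))
  have h4 : 0 ≤ ε * Set.indicator {m : ℕ | κ * x < m} (fun _ => (1 : ℝ)) n :=
    mul_nonneg hε (Set.indicator_nonneg (fun _ _ => zero_le_one) _)
  have h5 : 0 ≤ Real.exp ((∫ x, x ∂ν) * k / δ) * (κ ^ k * truncPow k (κ * x) n) :=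
    mul_nonneg (Real.exp_pos _).le (mul_nonneg (by positivity) (truncPow_nonneg _ _ _))
  by_cases hA : (1 - δ) * x < q + (∫ x, x ∂ν + δ) * n
  · rw [Set.indicator_of_mem (by exact hA)]
    linarith [sumTail_le_one (ν := ν) n (x - q)]
  rw [Set.indicator_of_notMem (by exact hA), zero_add]
  rw [not_lt] at hA
  have hm0 : 0 ≤ ∫ x, x ∂ν := integral_nonneg_of_ae hν
  have hsplit := sumTail_le_split hν n (x - q) (α * x) (δ / k * x)
  have e1 : x - q - α * x = (1 - α) * x - q := by ring
  rw [e1, mul_left_comm] at hsplit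
  refine hsplit.trans ?_
  rw [add_assoc _ (ε * _)]
  gcongr
  -- Many summands: the sum exceeds its mean by δn, which the law of large numbers makes unlikely.
  -- Few summands: the exponential bound.
  by_cases hn : κ * x < n
  · rw [Set.indicator_of_mem (by exact hn), mul_one]
    refine le_trans (le_trans ?_ (hw hn)) (le_add_of_nonneg_right h5)
    refine measureReal_mono fun r hr => lt_of_le_of_lt ?_ hr.1
    have : 0 ≤ δ * x := by positivity
    linarith
  · rw [Set.indicator_of_notMem (by exact hn), mul_zero, zero_add]
    rw [not_lt] at hn
    have hle : (iidLaw ν).real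
        {r | x - q < ∑ m ∈ Finset.range n, r m ∧ ∀ m < n, r m ≤ δ / k * x} ≤
        (iidLaw ν).real
        {r | k * (δ / k * x) < ∑ m ∈ Finset.range n, r m ∧ ∀ m < n, r m ≤ δ / k * x} := by
      refine measureReal_mono fun r hr => ⟨lt_of_le_of_lt ?_ hr.1, hr.2⟩
      have e : (k : ℝ) * (δ / k * x) = δ * x := by field_simp
      rw [e]
      have : 0 ≤ (∫ x, x ∂ν + δ) * n := by positivity
      linarith
    refine hle.trans ?_
    -- The case n = 0 is separate because the base A = x / n, used below, requires n > 0.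
    rcases Nat.eq_zero_or_pos n with h0 | h0
    · subst h0
      have he : {r : ℕ → ℝ | k * (δ / k * x) < ∑ m ∈ Finset.range 0, r m ∧
          ∀ m < 0, r m ≤ δ / k * x} = ∅ := by
        refine Set.eq_empty_of_forall_notMem fun r hr => ?_
        have h6 : (k : ℝ) * (δ / k * x) < ∑ m ∈ Finset.range 0, r m := hr.1
        rw [Finset.sum_range_zero] at h6
        have : 0 < (k : ℝ) * (δ / k * x) := by positivity
        linarith
      rw [he, measureReal_empty]
      exact h5
    · have hn0 : (0 : ℝ) < n := Nat.cast_pos.2 h0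
      have hA1 : 1 ≤ x / n := by
        rw [one_le_div hn0]
        nlinarith
      -- With A = x / n and w = δx / k the exponent is the constant (mean)·k / δ, and A^(-k) = (n /
      -- x)^k.
      refine (measureReal_sum_gt_bounded_le hν hi n k (by positivity) hA1).trans (le_of_eq ?_)
      rw [truncPow, if_pos hn, ← mul_pow, mul_comm]
      congr 2
      · field_simp
      · rw [← inv_pow]
        congr 1
        field_simp

end OneStep

/-! ### Sharp asymptotics of the tail -/

section Asymptotic

variable {Ω : Type*} [MeasurableSpace Ω] {μ : Measure Ω} [IsProbabilityMeasure μ]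
  {Q : Ω → ℝ} {N : Ω → ℕ} {ν : Measure ℝ} [IsProbabilityMeasure ν]

theorem real_Ioi_eq_integral_sumTail (hQ : Measurable Q) (hN : Measurable N)
    (hfix : randomSumLaw μ Q N ν = ν) (x : ℝ) :
    ν.real (Set.Ioi x) = ∫ ω, sumTail ν (N ω) (x - Q ω) ∂μ := by
  rw [← randomSumLaw_real_Ioi hQ hN, hfix]

/-- The one-step upper bound, for given values of the truncation parameters. -/
theorem real_Ioi_le_of_forall_sumTail_le (hQ : Measurable Q) (hN : Measurable N)
    (hNi : Integrable (fun ω => (N ω : ℝ)) μ) (hν : ∀ᵐ x ∂ν, 0 ≤ x)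
    (hi : Integrable (fun x : ℝ => x) ν) (hfix : randomSumLaw μ Q N ν = ν)
    {k : ℕ} (hk : 0 < k) {δ α κ ε x : ℝ} (hδ : 0 < δ) (hκ0 : 0 < κ) (hκ1 : κ ≤ 1) (hε : 0 ≤ ε)
    (hx : 0 < x) (hw : ∀ n : ℕ, κ * x < n → sumTail ν n ((∫ x, x ∂ν + δ) * n) ≤ ε) :
    ν.real (Set.Ioi x) ≤
      μ.real {ω | (1 - δ) * x < Q ω + (∫ x, x ∂ν + δ) * N ω} +
      (∫ ω, (N ω : ℝ) ∂μ) * ν.real (Set.Ioi (α * x)) +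
      ν.real (Set.Ioi (δ / k * x)) *
        ∫ ω, (N ω : ℝ) * sumTail ν (N ω) ((1 - α) * x - Q ω) ∂μ +
      ε * μ.real {ω | κ * x < (N ω : ℝ)} +
      Real.exp ((∫ x, x ∂ν) * k / δ) * (κ ^ k * ∫ ω, truncPow k (κ * x) (N ω) ∂μ) := by
  set C := Real.exp ((∫ x, x ∂ν) * k / δ)
  have hm1 : Measurable fun ω => Q ω + (∫ x, x ∂ν + δ) * N ω := by fun_prop
  have hm2 : Measurable fun ω => (N ω : ℝ) := by fun_prop
  have i1 := integrable_indicator_tail (μ := μ) _ hm1 ((1 - δ) * x)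
  have i2 := hNi.mul_const (ν.real (Set.Ioi (α * x)))
  have i3 := (integrable_mul_sumTail (ν := ν) hQ hN hNi ((1 - α) * x)).const_mul
    (ν.real (Set.Ioi (δ / k * x)))
  have i4 := (integrable_indicator_tail (μ := μ) _ hm2 (κ * x)).const_mul ε
  have i5 := ((integrable_truncPow (μ := μ) hN k (κ * x)).const_mul (κ ^ k)).const_mul C
  rw [real_Ioi_eq_integral_sumTail hQ hN hfix x]
  refine (integral_mono (integrable_sumTail hQ hN x) ((((i1.add i2).add i3).add i4).add i5)
    fun ω => sumTail_sub_le (q := Q ω) hν hi hk hδ hκ0 hκ1 hε hx (N ω) (hw (N ω))).trans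
    (le_of_eq ?_)
  rw [integral_add' (((i1.add i2).add i3).add i4) i5, integral_add' ((i1.add i2).add i3) i4,
    integral_add' (i1.add i2) i3, integral_add' i1 i2, integral_indicator_tail _ hm1,
    integral_mul_const, integral_const_mul, integral_const_mul, integral_const_mul,
    integral_const_mul, integral_indicator_tail _ hm2]

variable (hQ : Measurable Q) (hN : Measurable N) (hQ0 : ∀ᵐ ω ∂μ, 0 ≤ Q ω)
  (hNi : Integrable (fun ω => (N ω : ℝ)) μ) (hN1 : ∫ ω, (N ω : ℝ) ∂μ < 1)
  (hν : ∀ᵐ x ∂ν, 0 ≤ x) (hi : Integrable (fun x : ℝ => x) ν)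
  (hfix : randomSumLaw μ Q N ν = ν) {r : ℝ} (hr : 0 < r) (hmean : ∫ x, x ∂ν = r)
  (hF : IsIRVTail fun x => μ.real {ω | x < Q ω + r * (N ω : ℝ)})

include hQ hN hQ0 hNi hν hi hfix hr hmean hF in
/-- The one-step upper bound for the tail of the solution. -/
theorem eventually_tail_le {ε : ℝ} (hε : 0 < ε) :
    ∃ α : ℝ, 0 < α ∧ α < 1 ∧ (∀ᶠ x in atTop,
        μ.real {ω | α * x < Q ω + r * (N ω : ℝ)} ≤ (1 + ε) * μ.real {ω | x < Q ω + r * (N ω : ℝ)}) ∧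
      ∃ η : ℝ, 0 < η ∧ η < 1 ∧ ∀ ε' : ℝ, 0 < ε' → ∀ᶠ x in atTop,
        ν.real (Set.Ioi x) ≤ (1 + ε) * μ.real {ω | x < Q ω + r * (N ω : ℝ)} +
          (∫ ω, (N ω : ℝ) ∂μ) * ν.real (Set.Ioi (α * x)) + ε' * ν.real (Set.Ioi (η * x)) := by
  set F : ℝ → ℝ := fun x => μ.real {ω | x < Q ω + r * (N ω : ℝ)} with hFdef
  have hFa : Antitone F := antitone_tail μ _
  have hNF : ∀ x, 0 < x → μ.real {ω | x < (N ω : ℝ)} ≤ F (r * x) := by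
    intro x _
    refine ENNReal.toReal_mono (measure_ne_top _ _) (measure_mono_ae ?_)
    filter_upwards [hQ0] with ω hω h
    have h' : x < (N ω : ℝ) := h
    change r * x < Q ω + r * (N ω : ℝ)
    nlinarith
  obtain ⟨k, hk, hpow⟩ := exists_truncPow_integral_le hN hF hFa hr hNF
  have hk1 : (1 : ℝ) ≤ k := Nat.one_le_cast.2 hk
  obtain ⟨α, hα0, hα1, hα⟩ := hF.2 (ε / 3) (by positivity)
  -- The inequality says that Q + (r + δ)N > (1 - δ)x forces Q + rN > αx.
  obtain ⟨δ, hδ0, hδ1, hδ⟩ : ∃ δ : ℝ, 0 < δ ∧ δ < 1 ∧ α * (r + δ) ≤ (1 - δ) * r := by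
    refine ⟨(1 - α) * r / (r + 1), div_pos (mul_pos (by linarith) hr) (by linarith), ?_, ?_⟩
    · rw [div_lt_one (by linarith)]
      nlinarith
    · set δ := (1 - α) * r / (r + 1) with hδ
      have h1 : δ * (r + 1) = (1 - α) * r := div_mul_cancel₀ _ (by linarith)
      have h2 : 0 < δ := div_pos (mul_pos (by linarith) hr) (by linarith)
      nlinarith
  refine ⟨α, hα0, hα1, ?_, δ / k, by positivity, ?_, fun ε' hε' => ?_⟩
  · filter_upwards [hα] with x hx
    refine hx.trans ?_
    have := hF.1 x
    gcongr
    linarith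
  · rw [div_lt_one (by linarith)]
    linarith
  set C := Real.exp ((∫ x, x ∂ν) * k / δ)
  have hC : 0 < C := Real.exp_pos _
  obtain ⟨κ, hκ0, hκ1, hκ⟩ := hpow (ε / 3 / C) (by positivity)
  obtain ⟨D, hD1, hD⟩ := hF.exists_le_mul hFa (mul_pos hr hκ0)
  have hD0 : 0 < D := by linarith
  obtain ⟨n₀, hn₀⟩ := eventually_atTop.1 ((tendsto_sumTail_add hi hδ0).eventually_le_const
    (show 0 < ε / 3 / D by positivity))
  filter_upwards [hα, hκ, hD, eventually_gt_atTop 0, eventually_ge_atTop (n₀ / κ),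
    (tendsto_integral_mul_sumTail (ν := ν) hQ hN hNi
      (show 0 < 1 - α by linarith)).eventually_le_const hε'] with x h1 h2 h3 hx0 hxn h4
  have hmain := real_Ioi_le_of_forall_sumTail_le (α := α) hQ hN hNi hν hi hfix hk hδ0 hκ0 hκ1
    (show 0 ≤ ε / 3 / D by positivity) hx0 fun n hn => hn₀ n (by
      rw [div_le_iff₀ hκ0] at hxn
      have : (n₀ : ℝ) ≤ n := by linarith
      exact_mod_cast this)
  have hA : μ.real {ω | (1 - δ) * x < Q ω + (∫ x, x ∂ν + δ) * N ω} ≤ (1 + ε / 3) * F x := by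
    refine le_trans (ENNReal.toReal_mono (measure_ne_top _ _) (measure_mono_ae ?_)) h1
    filter_upwards [hQ0] with ω hω h
    have h' : (1 - δ) * x < Q ω + (∫ x, x ∂ν + δ) * N ω := h
    rw [hmean] at h'
    change α * x < Q ω + r * (N ω : ℝ)
    have h5 : α * (r + δ) * x ≤ (1 - δ) * r * x := mul_le_mul_of_nonneg_right hδ hx0.le
    have h6 : (1 - δ) * x * r < (Q ω + (r + δ) * N ω) * r := mul_lt_mul_of_pos_right h' hr
    have h7 : 0 ≤ δ * Q ω := mul_nonneg hδ0.le hω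
    have h8 : (r + δ) * (α * x) < (r + δ) * (Q ω + r * N ω) := by linarith
    exact lt_of_mul_lt_mul_left h8 (by linarith)
  have hB : ε / 3 / D * μ.real {ω | κ * x < (N ω : ℝ)} ≤ ε / 3 * F x := by
    have h5 := hNF _ (mul_pos hκ0 hx0)
    rw [← mul_assoc] at h5
    calc ε / 3 / D * μ.real {ω | κ * x < (N ω : ℝ)} ≤ ε / 3 / D * (D * F x) := by
          gcongr
          exact h5.trans h3
      _ = ε / 3 * F x := by field_simp
  have hE : C * (κ ^ k * ∫ ω, truncPow k (κ * x) (N ω) ∂μ) ≤ ε / 3 * F x := by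
    calc C * (κ ^ k * ∫ ω, truncPow k (κ * x) (N ω) ∂μ) ≤ C * (ε / 3 / C * F x) := by gcongr
      _ = ε / 3 * F x := by field_simp
  have hG : ν.real (Set.Ioi (δ / k * x)) *
      ∫ ω, (N ω : ℝ) * sumTail ν (N ω) ((1 - α) * x - Q ω) ∂μ ≤
      ε' * ν.real (Set.Ioi (δ / k * x)) := by
    rw [mul_comm]
    gcongr
  change _ ≤ (1 + ε) * F x + _ + _
  linarith

include hQ hN hQ0 hNi hN1 hν hi hfix hr hmean hF in
/-- The tail of the solution is dominated by the tail of `Q + r N`. -/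
theorem exists_tail_le_mul :
    ∃ K : ℝ, 0 ≤ K ∧ ∀ x, ν.real (Set.Ioi x) ≤ K * μ.real {ω | x < Q ω + r * (N ω : ℝ)} := by
  set F : ℝ → ℝ := fun x => μ.real {ω | x < Q ω + r * (N ω : ℝ)} with hFdef
  have hFa : Antitone F := antitone_tail μ _
  set n' := ∫ ω, (N ω : ℝ) ∂μ
  have hN0 : 0 ≤ n' := integral_nonneg fun ω => Nat.cast_nonneg _
  obtain ⟨α, hα0, hα1, hα, η, hη0, hη1, hup⟩ := eventually_tail_le hQ hN hQ0 hNi hν hi hfix hr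
    hmean hF (show 0 < (1 - n') / 4 by linarith)
  obtain ⟨D, hD1, hD⟩ := hF.exists_le_mul hFa hη0
  have hD0 : 0 < D := by linarith
  obtain ⟨x₀, hx₀⟩ := eventually_atTop.1
    (hα.and (hD.and (hup ((1 - n') / 4 / D) (div_pos (by linarith) hD0))))
  -- The contraction factor is n̄ plus two errors of at most (1 - n̄)/4 each, hence (1 + n̄)/2 < 1.
  obtain ⟨K, hK⟩ := exists_forall_le_of_recursive (h := fun x => ν.real (Set.Ioi x) / F x)
    (C := 1 + (1 - n') / 4) (θ := (1 + n') / 2) (ρ := max α η) (x₀ := max x₀ 0) (by linarith)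
    (lt_max_of_lt_left hα0) (max_lt hα1 hη1)
    (fun x => ⟨1 / F x, fun y hy =>
      div_le_div₀ zero_le_one measureReal_le_one (hF.1 x) (hFa hy)⟩)
    (by
      intro x hx K hK0 hKy
      have hx0 : 0 ≤ x := (le_max_right _ _).trans hx
      obtain ⟨h1, h2, h3⟩ := hx₀ x ((le_max_left _ _).trans hx)
      have h4 := hKy (α * x) (by gcongr; exact le_max_left _ _)
      have h5 := hKy (η * x) (by gcongr; exact le_max_right _ _)
      rw [div_le_iff₀ (hF.1 _)] at h4 h5
      rw [div_le_iff₀ (hF.1 _)]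
      have hFx : 0 < F x := hF.1 x
      have h6 : n' * ν.real (Set.Ioi (α * x)) ≤ n' * (K * ((1 + (1 - n') / 4) * F x)) := by
        gcongr
        exact h4.trans (by gcongr)
      have h7 : (1 - n') / 4 / D * ν.real (Set.Ioi (η * x)) ≤
          (1 - n') / 4 / D * (K * (D * F x)) :=
        mul_le_mul_of_nonneg_left (h5.trans (by gcongr)) (div_nonneg (by linarith) hD0.le)
      have h8 : (1 - n') / 4 / D * (K * (D * F x)) = (1 - n') / 4 * (K * F x) := by field_simp
      have h9 : n' * ((1 - n') / 4 * (K * F x)) ≤ 1 * ((1 - n') / 4 * (K * F x)) :=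
        mul_le_mul_of_nonneg_right hN1.le
          (mul_nonneg (by linarith) (mul_nonneg hK0 hFx.le))
      change ν.real (Set.Ioi x) ≤ (1 + (1 - n') / 4) * F x + _ + _ at h3
      nlinarith)
  refine ⟨max K 0, le_max_right _ _, fun x => ((div_le_iff₀ (hF.1 x)).1 (hK x)).trans ?_⟩
  have := hF.1 x
  gcongr
  exact le_max_left _ _

include hQ hN hQ0 hNi hN1 hν hi hfix hr hmean hF in
-- Inserts the bound G ≤ KF into the right side of the one-step inequality; the error parameters are
-- chosen, given K and D, so that they add up to at most ε.
theorem eventually_tail_le_of_eventually_tail_le {K ε : ℝ} (hK0 : 0 ≤ K) (hε : 0 < ε)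
    (hK : ∀ᶠ x in atTop, ν.real (Set.Ioi x) ≤ K * μ.real {ω | x < Q ω + r * (N ω : ℝ)}) :
    ∀ᶠ x in atTop, ν.real (Set.Ioi x) ≤
      (1 + ε + (∫ ω, (N ω : ℝ) ∂μ) * K) * μ.real {ω | x < Q ω + r * (N ω : ℝ)} := by
  set F : ℝ → ℝ := fun x => μ.real {ω | x < Q ω + r * (N ω : ℝ)} with hFdef
  have hFa : Antitone F := antitone_tail μ _
  set n' := ∫ ω, (N ω : ℝ) ∂μ
  have hN0 : 0 ≤ n' := integral_nonneg fun ω => Nat.cast_nonneg _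
  set ε₁ := ε / (2 * (1 + K)) with hε₁
  have hε₁0 : 0 < ε₁ := by positivity
  have hε₁e : ε₁ * (1 + K) = ε / 2 := by rw [hε₁]; field_simp
  obtain ⟨α, hα0, hα1, hα, η, hη0, hη1, hup⟩ := eventually_tail_le hQ hN hQ0 hNi hν hi hfix hr
    hmean hF hε₁0
  obtain ⟨D, hD1, hD⟩ := hF.exists_le_mul hFa hη0
  have hD0 : 0 < D := by linarith
  set ε₂ := ε / (2 * (K + 1) * D) with hε₂
  have hε₂0 : 0 < ε₂ := by positivity
  have hε₂e : ε₂ * (K + 1) * D = ε / 2 := by rw [hε₂]; field_simp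
  filter_upwards [hα, hD, hup ε₂ hε₂0, (tendsto_id.const_mul_atTop hα0).eventually hK,
    (tendsto_id.const_mul_atTop hη0).eventually hK] with x h1 h2 h3 h4 h5
  simp only [id] at h4 h5
  have hFx : 0 < F x := hF.1 x
  have h6 : n' * ν.real (Set.Ioi (α * x)) ≤ n' * (K * ((1 + ε₁) * F x)) := by
    gcongr
    exact h4.trans (by gcongr)
  have h7 : ε₂ * ν.real (Set.Ioi (η * x)) ≤ ε₂ * (K * (D * F x)) := by
    gcongr
    exact h5.trans (by gcongr)
  have h8 : ε₂ * (K * (D * F x)) ≤ ε / 2 * F x := by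
    rw [← hε₂e]
    have : 0 < ε₂ * D * F x := by positivity
    nlinarith
  have h9 : n' * (ε₁ * (K * F x)) ≤ 1 * (ε₁ * (K * F x)) := by gcongr
  have h10 : ε₁ * (1 + K) * F x = ε / 2 * F x := by rw [hε₁e]
  change ν.real (Set.Ioi x) ≤ (1 + ε₁) * F x + _ + _ at h3
  change _ ≤ (1 + ε + n' * K) * F x
  nlinarith

include hQ hN hQ0 hNi hN1 hν hi hfix hr hmean hF in
/-- The sharp upper bound for the tail of the solution. -/
theorem eventually_tail_le_sharp {c : ℝ} (hc : 1 / (1 - ∫ ω, (N ω : ℝ) ∂μ) < c) :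
    ∀ᶠ x in atTop, ν.real (Set.Ioi x) ≤ c * μ.real {ω | x < Q ω + r * (N ω : ℝ)} := by
  obtain ⟨K, hK0, hK⟩ := exists_tail_le_mul hQ hN hQ0 hNi hN1 hν hi hfix hr hmean hF
  set n' := ∫ ω, (N ω : ℝ) ∂μ
  have hN0 : 0 ≤ n' := integral_nonneg fun ω => Nat.cast_nonneg _
  have h1n : 0 < 1 - n' := by linarith
  obtain ⟨b, hb1, hb2⟩ := exists_between hc
  -- With this ε, b is the fixed point of K ↦ 1 + ε + n̄K, so j improvements leave the excess n̄^j
  -- K.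
  set ε := b * (1 - n') - 1 with hε
  have hε0 : 0 < ε := by
    rw [div_lt_iff₀ h1n] at hb1
    linarith
  have hb0 : 0 < b := lt_trans (by positivity) hb1
  have key : ∀ j : ℕ, ∀ᶠ x in atTop, ν.real (Set.Ioi x) ≤
      (b + n' ^ j * K) * μ.real {ω | x < Q ω + r * (N ω : ℝ)} := by
    intro j
    induction j with
    | zero =>
      refine .of_forall fun x => (hK x).trans ?_
      rw [pow_zero, one_mul]
      gcongr
      linarith
    | succ j ih =>
      have h := eventually_tail_le_of_eventually_tail_le hQ hN hQ0 hNi hN1 hν hi hfix hr hmean hF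
        (by positivity) hε0 ih
      filter_upwards [h] with x hx
      refine hx.trans (le_of_eq ?_)
      change (1 + ε + n' * (b + n' ^ j * K)) * _ = _
      rw [hε]
      ring
  have hlim : Tendsto (fun j : ℕ => b + n' ^ j * K) atTop (𝓝 (b + 0 * K)) :=
    ((tendsto_pow_atTop_nhds_zero_of_lt_one hN0 hN1).mul_const K).const_add b
  rw [zero_mul, add_zero] at hlim
  obtain ⟨j, hj⟩ := (hlim.eventually_lt_const hb2).exists
  filter_upwards [key j] with x hx
  exact hx.trans (by gcongr)

/-- Lower bound for the probability that a random sum is large, given the number of summands. -/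
theorem le_sumTail_sub (hν : ∀ᵐ x ∂ν, 0 ≤ x) {δ ε x q r : ℝ} (hδ : 0 < δ) (hx : 0 < x)
    (n : ℕ) (hq : 0 ≤ q)
    (hw : 1 - ε ≤ sumTail ν n ((r - δ) * n - δ * x)) :
    (1 - ε) * Set.indicator {p : ℝ × ℕ | (1 + δ) * x < p.1 + (r - δ) * p.2} (fun _ => 1) (q, n) +
      ν.real (Set.Ioi x) * Set.indicator {p : ℝ × ℕ | p.1 + r * p.2 ≤ x}
        (fun p => ∑ j ∈ Finset.range p.2, (1 - ν.real (Set.Ioi x)) ^ j) (q, n) ≤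
      sumTail ν n (x - q) := by
  have hn : (0 : ℝ) ≤ n := Nat.cast_nonneg n
  -- The two scenarios exclude each other. In the first the threshold x - q is below the
  -- law-of-large-numbers level; in the second a single summand above x suffices.
  by_cases hA : (1 + δ) * x < q + (r - δ) * n
  · have hB : ¬ q + r * n ≤ x := by
      have : 0 ≤ δ * n := by positivity
      have : 0 ≤ δ * x := by positivity
      intro h
      linarith
    rw [Set.indicator_of_mem (by exact hA), Set.indicator_of_notMem (by exact hB), mul_zero,
      mul_one, add_zero]
    exact hw.trans (antitone_sumTail n (by linarith))
  · rw [Set.indicator_of_notMem (by exact hA), mul_zero, zero_add]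
    by_cases hB : q + r * n ≤ x
    · rw [Set.indicator_of_mem (by exact hB)]
      refine le_trans (le_of_eq ?_) ((one_sub_pow_le_sumTail hν n x).trans
        (antitone_sumTail n (by linarith)))
      have h := mul_neg_geom_sum (1 - ν.real (Set.Ioi x)) n
      rw [sub_sub_cancel] at h
      exact h
    · rw [Set.indicator_of_notMem (by exact hB), mul_zero]
      exact sumTail_nonneg _ _

/-- Uniformity in n: the law of large numbers covers n ≥ n₀, and for the finitely many smaller n the
term -δx makes the threshold negative, so the probability is 1. -/
theorem eventually_forall_le_sumTail (hν : ∀ᵐ x ∂ν, 0 ≤ x) (hi : Integrable (fun x : ℝ => x) ν)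
    {δ ε : ℝ} (hδ : 0 < δ) (hε : 0 < ε) :
    ∀ᶠ x in atTop, ∀ n : ℕ, 1 - ε ≤ sumTail ν n ((∫ x, x ∂ν - δ) * n - δ * x) := by
  obtain ⟨n₀, hn₀⟩ := eventually_atTop.1 ((tendsto_sumTail_sub hi hδ).eventually_const_le
    (show 1 - ε < 1 by linarith))
  have h : ∀ᶠ x : ℝ in atTop, ∀ n ∈ Finset.range n₀, (∫ x, x ∂ν - δ) * n < δ * x :=
    (Finset.eventually_all _).2 fun n _ =>
      (tendsto_id.const_mul_atTop hδ).eventually_gt_atTop _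
  filter_upwards [h, eventually_ge_atTop 0] with x hx hx0 n
  rcases le_or_gt n₀ n with hn | hn
  · exact (hn₀ n hn).trans (antitone_sumTail n (by nlinarith))
  · have h1 : sumTail ν n ((∫ x, x ∂ν - δ) * n - δ * x) = 1 := by
      rw [sumTail, ← probReal_univ (μ := iidLaw ν)]
      refine measureReal_congr ?_
      filter_upwards [ae_iidLaw_nonneg hν] with r hr
      refine propext (iff_of_true ?_ trivial)
      have := hx n (Finset.mem_range.2 hn)
      exact lt_of_lt_of_le (by linarith) (Finset.sum_nonneg fun i _ => hr i)
    linarith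

include hQ hN hQ0 hNi hN1 hν hi hfix hr hmean hF in
/-- The sharp lower bound for the tail of the solution. -/
theorem eventually_le_tail_sharp {c : ℝ} (hc : c < 1 / (1 - ∫ ω, (N ω : ℝ) ∂μ)) :
    ∀ᶠ x in atTop, c * μ.real {ω | x < Q ω + r * (N ω : ℝ)} ≤ ν.real (Set.Ioi x) := by
  set F : ℝ → ℝ := fun x => μ.real {ω | x < Q ω + r * (N ω : ℝ)} with hFdef
  have hFa : Antitone F := antitone_tail μ _
  set n' := ∫ ω, (N ω : ℝ) ∂μ with hn'
  have hN0 : 0 ≤ n' := integral_nonneg fun ω => Nat.cast_nonneg _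
  have h1n : 0 < 1 - n' := by linarith
  obtain ⟨ε, hε0, hε1, hεc⟩ : ∃ ε : ℝ, 0 < ε ∧ ε < 1 ∧ c * (1 - n' + ε) * (1 + ε) < 1 - ε := by
    have hcont : Continuous fun ε : ℝ => c * (1 - n' + ε) * (1 + ε) - (1 - ε) := by fun_prop
    have h0 : c * (1 - n' + 0) * (1 + 0) - (1 - 0) < 0 := by
      rw [lt_div_iff₀ h1n] at hc
      linarith
    have h1 := hcont.continuousAt.eventually_lt_const h0
    obtain ⟨ε, h2, h3⟩ := ((h1.filter_mono nhdsWithin_le_nhds).and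
      (Ioo_mem_nhdsGT (zero_lt_one (α := ℝ)))).exists
    exact ⟨ε, h3.1, h3.2, by linarith⟩
  obtain ⟨α, hα0, hα1, hα⟩ := hF.2 ε hε0
  -- The inequality says that Q + rN > x / α forces Q + (r - δ)N > (1 + δ)x.
  obtain ⟨δ, hδ0, hδr, hδ⟩ : ∃ δ : ℝ, 0 < δ ∧ δ < r ∧ α * (1 + δ) * r ≤ r - δ := by
    refine ⟨(1 - α) * r / (1 + r), div_pos (mul_pos (by linarith) hr) (by linarith), ?_, ?_⟩
    · rw [div_lt_iff₀ (by linarith)]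
      nlinarith [mul_pos hα0 hr]
    · set δ := (1 - α) * r / (1 + r) with hδ
      have h1 : δ * (1 + r) = (1 - α) * r := div_mul_cancel₀ _ (by linarith)
      have h2 : 0 < δ := div_pos (mul_pos (by linarith) hr) (by linarith)
      nlinarith [mul_pos h2 hr]
  have hm1 : Measurable fun ω => Q ω + (r - δ) * N ω := by fun_prop
  have hgs := (tendsto_integral_geom_sum (ν := ν) hQ hN hNi r).eventually_const_le
    (show n' - ε < n' by linarith)
  have hw := eventually_forall_le_sumTail hν hi hδ0 hε0
  rw [hmean] at hw
  filter_upwards [hgs, hw, (tendsto_id.atTop_div_const hα0).eventually hα, eventually_gt_atTop 0]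
    with x h1 h2 h3 hx
  simp only [id] at h3
  rw [mul_div_cancel₀ _ hα0.ne'] at h3
  set G := ν.real (Set.Ioi x) with hG
  have hG0 : 0 ≤ G := measureReal_nonneg
  have hgeom0 : ∀ n : ℕ, 0 ≤ ∑ j ∈ Finset.range n, (1 - G) ^ j := fun n =>
    Finset.sum_nonneg fun j _ => pow_nonneg (sub_nonneg.2 measureReal_le_one) j
  have i1 := (integrable_indicator_tail (μ := μ) _ hm1 ((1 + δ) * x)).const_mul (1 - ε)
  have i2 : Integrable (fun ω => G * Set.indicator {ω | Q ω + r * N ω ≤ x}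
      (fun ω => ∑ j ∈ Finset.range (N ω), (1 - G) ^ j) ω) μ := by
    refine Integrable.const_mul (hNi.mono' ?_ (.of_forall fun ω => ?_)) G
    · refine (Measurable.indicator ((measurable_from_nat (f := fun n : ℕ =>
        ∑ j ∈ Finset.range n, (1 - G) ^ j)).comp hN) ?_).aestronglyMeasurable
      exact measurableSet_le (by fun_prop) measurable_const
    · rw [Real.norm_of_nonneg (Set.indicator_nonneg (fun _ _ => hgeom0 _) _)]
      refine (Set.indicator_le_self' (fun _ _ => hgeom0 _) _).trans ?_
      refine (Finset.sum_le_card_nsmul _ _ 1 fun j _ =>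
        pow_le_one₀ (sub_nonneg.2 measureReal_le_one) (sub_le_self _ hG0)).trans ?_
      simp
  have hint : (1 - ε) * μ.real {ω | (1 + δ) * x < Q ω + (r - δ) * N ω} +
      G * ∫ ω, Set.indicator {ω | Q ω + r * N ω ≤ x}
        (fun ω => ∑ j ∈ Finset.range (N ω), (1 - G) ^ j) ω ∂μ ≤ G := by
    have h := integral_mono_ae (i1.add i2) (integrable_sumTail (ν := ν) hQ hN x) (by
      filter_upwards [hQ0] with ω hω
      exact le_sumTail_sub hν hδ0 hx (N ω) hω (h2 (N ω)))
    rwa [← real_Ioi_eq_integral_sumTail hQ hN hfix x, integral_add' i1 i2, integral_const_mul,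
      integral_const_mul, integral_indicator_tail _ hm1] at h
  have hA : F (x / α) ≤ μ.real {ω | (1 + δ) * x < Q ω + (r - δ) * N ω} := by
    refine ENNReal.toReal_mono (measure_ne_top _ _) (measure_mono_ae ?_)
    filter_upwards [hQ0] with ω hω h
    have h' : x / α < Q ω + r * N ω := h
    rw [div_lt_iff₀ hα0] at h'
    change (1 + δ) * x < Q ω + (r - δ) * N ω
    have h5 : (1 + δ) * r * x < (1 + δ) * r * ((Q ω + r * N ω) * α) :=
      mul_lt_mul_of_pos_left h' (by positivity)
    have hs : 0 ≤ Q ω + r * N ω := by positivity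
    have h6 : α * (1 + δ) * r * (Q ω + r * N ω) ≤ (r - δ) * (Q ω + r * N ω) :=
      mul_le_mul_of_nonneg_right hδ hs
    have h7 : 0 ≤ δ * Q ω := mul_nonneg hδ0.le hω
    have h8 : r * ((1 + δ) * x) < r * (Q ω + (r - δ) * N ω) := by linarith
    exact lt_of_mul_lt_mul_left h8 hr.le
  have hFx : 0 < F x := hF.1 x
  have hFα : 0 < F (x / α) := hF.1 _
  have h4 : G * (n' - ε) ≤ G * ∫ ω, Set.indicator {ω | Q ω + r * N ω ≤ x}
        (fun ω => ∑ j ∈ Finset.range (N ω), (1 - G) ^ j) ω ∂μ := by gcongr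
  have h5 : (1 - ε) * F (x / α) ≤ (1 - ε) * μ.real {ω | (1 + δ) * x < Q ω + (r - δ) * N ω} :=
    mul_le_mul_of_nonneg_left hA (by linarith)
  have h6 : (1 - ε) * F (x / α) ≤ G * (1 - n' + ε) := by linarith
  rcases le_or_gt c 0 with hc0 | hc0
  · exact (mul_nonpos_of_nonpos_of_nonneg hc0 hFx.le).trans hG0
  · have h7 : c * F x ≤ c * ((1 + ε) * F (x / α)) := mul_le_mul_of_nonneg_left h3 hc0.le
    have h8 : c * (1 - n' + ε) * (1 + ε) * F (x / α) ≤ (1 - ε) * F (x / α) := by gcongr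
    have h9 : (1 - n' + ε) * (c * F x) ≤ (1 - n' + ε) * G := by nlinarith
    exact le_of_mul_le_mul_left h9 (by linarith)

include hQ hN hQ0 hNi hN1 hν hi hfix hr hmean hF in
theorem isEquivalent_tail : (fun x : ℝ => ν.real (Set.Ioi x)) ~[atTop]
    fun x : ℝ => 1 / (1 - ∫ ω, (N ω : ℝ) ∂μ) * μ.real {ω | x < Q ω + r * (N ω : ℝ)} := by
  set b := 1 / (1 - ∫ ω, (N ω : ℝ) ∂μ) with hb
  have hb0 : 0 < b := div_pos one_pos (by linarith)
  rw [IsEquivalent, isLittleO_iff]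
  intro ε hε
  filter_upwards [eventually_tail_le_sharp hQ hN hQ0 hNi hN1 hν hi hfix hr hmean hF
      (show b < b * (1 + ε) by nlinarith),
    eventually_le_tail_sharp hQ hN hQ0 hNi hN1 hν hi hfix hr hmean hF
      (show b * (1 - ε) < b by nlinarith)] with x h1 h2
  have hFx := hF.1 x
  rw [Pi.sub_apply, Real.norm_of_nonneg (mul_pos hb0 hFx).le, Real.norm_eq_abs, abs_le]
  constructor <;> linarith

end Asymptotic

/-- If r̄ = 0, then R and Q vanish almost surely and both tails are 0 for x ≥ 0. Otherwise (C) is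
applied at the centre c = r̄. -/
theorem tail_isEquivalent_of_conditionC {Ω : Type*} [MeasurableSpace Ω] {μ : Measure Ω}
    [IsProbabilityMeasure μ] {Q : Ω → ℝ} {N : Ω → ℕ} (hQ : Measurable Q) (hN : Measurable N)
    (hQ0 : ∀ᵐ ω ∂μ, 0 ≤ Q ω) (hQi : Integrable Q μ) (hNi : Integrable (fun ω => (N ω : ℝ)) μ)
    (hN1 : ∫ ω, (N ω : ℝ) ∂μ < 1) {ν : ProbabilityMeasure ℝ} (h : IsNonnegSolution μ Q N ν)
    (hm : HasFiniteMean ν) (hC : ConditionC μ Q N) :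
    (fun x : ℝ => (ν : Measure ℝ).real (Set.Ioi x)) ~[atTop]
      fun x : ℝ => 1 / (1 - ∫ ω, (N ω : ℝ) ∂μ) *
        μ.real {ω | x < Q ω + rBar μ Q N * (N ω : ℝ)} := by
  have hmean := h.integral_eq hQ hN hQ0 hQi hNi hN1 hm
  have hr0 : 0 ≤ rBar μ Q N := hmean ▸ integral_nonneg_of_ae h.1
  rcases hr0.eq_or_lt with hr | hr
  · have hν : ∀ᵐ x ∂(ν : Measure ℝ), x = 0 :=
      (integral_eq_zero_iff_of_nonneg_ae h.1 hm).1 (hmean.trans hr.symm)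
    have hQz : ∀ᵐ ω ∂μ, Q ω = 0 := by
      refine (integral_eq_zero_iff_of_nonneg_ae hQ0 hQi).1 ?_
      have := hr.symm
      rwa [rBar, div_eq_zero_iff, or_iff_left (by linarith)] at this
    refine IsEquivalent.congr_right ?_ (v := fun x : ℝ => (ν : Measure ℝ).real (Set.Ioi x)) ?_
    · exact IsEquivalent.refl
    · filter_upwards [eventually_ge_atTop 0] with x hx
      have h1 : (ν : Measure ℝ).real (Set.Ioi x) = 0 := by
        rw [measureReal_eq_zero_iff]
        refine measure_eq_zero_iff_ae_notMem.2 ?_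
        filter_upwards [hν] with y hy hxy
        rw [hy] at hxy
        exact not_lt.2 hx hxy
      have h2 : μ.real {ω | x < Q ω + rBar μ Q N * (N ω : ℝ)} = 0 := by
        rw [measureReal_eq_zero_iff]
        refine measure_eq_zero_iff_ae_notMem.2 ?_
        filter_upwards [hQz] with ω hω hxy
        have hxy' : x < Q ω + rBar μ Q N * (N ω : ℝ) := hxy
        rw [hω, ← hr, zero_mul, zero_add] at hxy'
        exact not_lt.2 hx hxy'
      rw [h1, h2, mul_zero]
  · obtain ⟨ε, hε, hC⟩ := hC
    have hF := (isIRV_map_iff (by fun_prop)).1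
      (hC (rBar μ Q N) ⟨by linarith, by linarith⟩ hr)
    exact isEquivalent_tail hQ hN hQ0 hNi hN1 h.1 hm h.2 hr hmean hF

end RandomSum

theorem mainTheorem1 {Ω : Type*} [MeasurableSpace Ω] (μ : Measure Ω) [IsProbabilityMeasure μ]
    (Q : Ω → ℝ) (N : Ω → ℕ) (hQ : Measurable Q) (hN : Measurable N)
    (hQ_nonneg : ∀ᵐ ω ∂μ, 0 ≤ Q ω)
    (hQ_int : Integrable Q μ) (hN_int : Integrable (fun ω => (N ω : ℝ)) μ)
    (hN_lt : ∫ ω, (N ω : ℝ) ∂μ < 1) :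
    -- (i) existence, uniqueness and the mean
    (∃! ν : ProbabilityMeasure ℝ,
      RandomSum.IsNonnegSolution μ Q N ν ∧ RandomSum.HasFiniteMean ν) ∧
    (∀ ν : ProbabilityMeasure ℝ,
      RandomSum.IsNonnegSolution μ Q N ν → RandomSum.HasFiniteMean ν →
        (∫ x, x ∂(ν : Measure ℝ) = (∫ ω, Q ω ∂μ) / (1 - ∫ ω, (N ω : ℝ) ∂μ)) ∧
        -- (ii) the tail of the solution under condition (C)
        (RandomSum.ConditionC μ Q N →
          (fun x : ℝ => (ν : Measure ℝ).real (Set.Ioi x)) ~[atTop]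
            (fun x : ℝ => 1 / (1 - ∫ ω, (N ω : ℝ) ∂μ) *
              μ.real {ω | x < Q ω + RandomSum.rBar μ Q N * (N ω : ℝ)}))) ∧
    -- (iii) three sufficient conditions for (C)
    (RandomSum.IsMRV (μ.map (fun ω => (Q ω, (N ω : ℝ)))) → RandomSum.ConditionC μ Q N) ∧
    (RandomSum.IsIRV (μ.map Q) →
      (fun x : ℝ => μ.real {ω | x < (N ω : ℝ)}) =o[atTop] (fun x : ℝ => μ.real {ω | x < Q ω}) →
        RandomSum.ConditionC μ Q N) ∧
    (RandomSum.IsIRV (μ.map (fun ω => (N ω : ℝ))) →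
      (fun x : ℝ => μ.real {ω | x < Q ω}) =o[atTop] (fun x : ℝ => μ.real {ω | x < (N ω : ℝ)}) →
        RandomSum.ConditionC μ Q N) := by
  refine ⟨?_, fun ν hν hm => ⟨hν.integral_eq hQ hN hQ_nonneg hQ_int hN_int hN_lt hm,
    RandomSum.tail_isEquivalent_of_conditionC hQ hN hQ_nonneg hQ_int hN_int hN_lt hν hm⟩,
    RandomSum.conditionC_of_isMRV hQ hN hQ_nonneg, RandomSum.conditionC_of_isIRV_left hQ hN,
    RandomSum.conditionC_of_isIRV_right hQ hN hQ_nonneg⟩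
  obtain ⟨ν, hν⟩ := RandomSum.exists_isNonnegSolution hQ hN hQ_nonneg hQ_int hN_int hN_lt
  exact ⟨ν, hν, fun ν' hν' => hν'.1.eq hQ hN hN_int hN_lt hν.1⟩
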